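/- Let $\kappa>0$, let $B_1\subset\mathbb R^2$ be the open unit disk, and equip the complex Sobolev space $H^1(B_1)$ with the scalar product $$(u,v)_{\mathcal B}:=(u,v)_{L^2(B_1)}+\kappa^{-2}(\nabla u,\nabla v)_{L^2(B_1)}$$ (linear in $u$) and the norm $\|u\|_{\mathcal B}^2:=(u,u)_{\mathcal B}$. For $p\in\mathbb Z$ let $\tilde b_p(r,\theta):=J_p(\kappa r)e^{\imath p\theta}$ in polar coordinates, with $J_p$ the Bessel function of the first kind, let $\beta_p:=\|\tilde b_p\|_{\mathcal B}^{-1}$ and $b_p:=\beta_p\tilde b_p$, and let $\mathcal B$ be the closure of $\operatorname{span}\{b_p\}_{p\in\mathbb Z}$ in $H^1(B_1)$. Let $Y:=[0,2\pi)\times\mathbb R$ and, for $\mathbf y=(\varphi,\zeta)\in Y$, $$w(\mathbf y):=e^{-\kappa\sinh|\zeta|+|\zeta|/4},\qquad \phi_{\mathbf y}(\mathbf x):=e^{\imath\kappa\left(x_1\cos(\varphi+\imath\zeta)+x_2\sin(\varphi+\imath\zeta)\right)},\quad \mathbf x=(x_1,x_2)\in B_1 .$$ For $p\in\mathbb Z$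 let $\tilde a_p(\varphi,\zeta):=e^{p\zeta}e^{\imath p\varphi}$, $\alpha_p:=\left(\int_Y|\tilde a_p|^2w^2\,\mathrm d\mathbf y\right)^{-1/2}$ and $\tau_p:=\imath^p(\alpha_p\beta_p)^{-1}$, and let $\tau_-:=\inf_{p\in\mathbb Z}|\tau_p|$ and $\tau_+:=\sup_{p\in\mathbb Z}|\tau_p|$. Then $0<\tau_-\le\tau_+<\infty$, and the family of evanescent plane waves $\{\phi_{\mathbf y}\}_{\mathbf y\in Y}$ is a continuous frame for $\mathcal B$ with respect to the measure $w^2\,\mathrm d\mathbf y$ on $Y$: every $\phi_{\mathbf y}$ belongs to $\mathcal B$, for every $u\in\mathcal B$ the function $\mathbf y\mapsto(u,\phi_{\mathbf y})_{\mathcal B}$ is measurable on $Y$, and there are constants $A,B>0$ such that $$A\|u\|_{\mathcal B}^2\le\int_Y|(u,\phi_{\mathbf y})_{\mathcal B}|^2\,w^2(\mathbf y)\,\mathrm d\mathbf y\le B\|u\|_{\mathcal B}^2\qquad\text{for all }u\in\mathcal B .$$ Moreover, the optimal frame bounds are $A=\tau_-^2$ and $B=\tau_+^2$: the largest constant $A>0$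 for which the first inequality holds for all $u\in\mathcal B$ is $\tau_-^2$, and the smallest constant $B>0$ for which the second one does is $\tau_+^2$. -/

import Mathlib

open MeasureTheory
open scoped ContDiff ENNReal

noncomputable section

namespace Helmholtz

/-! ## The Sobolev space `H¹` of the unit disk, with the `κ`-weighted inner product -/

/-- The Euclidean plane. -/
abbrev Plane : Type := EuclideanSpace ℝ (Fin 2)

/-- The open unit disk. -/
def unitDisk : Set Plane := Metric.ball 0 1

/-- The Lebesgue measure on the unit disk. -/
abbrev diskMeasure : Measure Plane := volume.restrict unitDisk

/-- The complex space `L²` of the unit disk. -/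
abbrev L2Disk : Type := Lp ℂ 2 diskMeasure

/-- The partial derivative `∂f/∂xⱼ` of a function on the plane. -/
def partialDeriv (j : Fin 2) (f : Plane → ℂ) (x : Plane) : ℂ :=
  fderiv ℝ f x (EuclideanSpace.single j 1)

/-- `ψ` is a smooth function with compact support in the open unit disk. -/
def IsTestFunction (ψ : Plane → ℂ) : Prop :=
  ContDiff ℝ ∞ ψ ∧ HasCompactSupport ψ ∧ tsupport ψ ⊆ unitDisk

/-- `g = (g₀, g₁)` is the weak gradient of `u` in the unit disk. -/
def HasWeakGradient (u : L2Disk) (g : Fin 2 → L2Disk) : Prop :=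
  ∀ ψ : Plane → ℂ, IsTestFunction ψ → ∀ j : Fin 2,
    ∫ x in unitDisk, u x * partialDeriv j ψ x = - ∫ x in unitDisk, g j x * ψ x

theorem contDiff_partialDeriv {n m : WithTop ℕ∞} (j : Fin 2) {f : Plane → ℂ}
    (hf : ContDiff ℝ n f) (h : m + 1 ≤ n) : ContDiff ℝ m (partialDeriv j f) :=
  (hf.fderiv_right h).clm_apply contDiff_const

instance : IsFiniteMeasure diskMeasure :=
  ⟨by simp [unitDisk]⟩

theorem memLp_of_continuous {f : Plane → ℂ} (hf : Continuous f) : MemLp f 2 diskMeasure := by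
  obtain ⟨C, hC⟩ := (isCompact_closedBall (0 : Plane) 1).exists_bound_of_continuousOn
    hf.continuousOn
  refine MemLp.of_bound hf.aestronglyMeasurable C ?_
  refine (ae_restrict_iff' (by exact measurableSet_ball)).2 (Filter.Eventually.of_forall ?_)
  exact fun x hx => hC x (Metric.ball_subset_closedBall hx)

theorem integral_mul_eq_inner {f : Plane → ℂ} (hf : Continuous f) (u : L2Disk) :
    ∫ x in unitDisk, u x * f x =
      inner ℂ ((memLp_of_continuous (Complex.continuous_conj.comp hf)).toLp _) u := by
  rw [L2.inner_def]
  refine integral_congr_ae ?_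
  filter_upwards [(memLp_of_continuous (Complex.continuous_conj.comp hf)).coeFn_toLp] with x hx
  rw [hx]
  simp [RCLike.inner_apply]

/-- The Hilbert sum `L² ⊕ (L² ⊕ L²)`. -/
abbrev JetSpace : Type := WithLp 2 (L2Disk × PiLp 2 (fun _ : Fin 2 => L2Disk))

/-- The subspace of the pairs `(u, κ⁻¹ ∇u)`, where `u ∈ L²` has the weak gradient `∇u`
in `L² ⊕ L²`. -/
def weightedGraph (κ : ℝ) : Submodule ℂ JetSpace where
  carrier := {U | HasWeakGradient U.fst (fun j => (κ : ℂ) • U.snd j)}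
  zero_mem' := by
    intro ψ hψ j
    rw [integral_mul_eq_inner (contDiff_partialDeriv (m := 0) j hψ.1 (by simp)).continuous,
      integral_mul_eq_inner hψ.1.continuous]
    simp
  add_mem' := by
    intro U V hU hV ψ hψ j
    have h1 := hU ψ hψ j
    have h2 := hV ψ hψ j
    rw [integral_mul_eq_inner (contDiff_partialDeriv (m := 0) j hψ.1 (by simp)).continuous,
      integral_mul_eq_inner hψ.1.continuous] at h1 h2 ⊢
    simp only [WithLp.add_fst, WithLp.add_snd, PiLp.add_apply, smul_add, inner_add_right, h1, h2]
    ring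
  smul_mem' := by
    intro c U hU ψ hψ j
    have h1 := hU ψ hψ j
    rw [integral_mul_eq_inner (contDiff_partialDeriv (m := 0) j hψ.1 (by simp)).continuous,
      integral_mul_eq_inner hψ.1.continuous] at h1 ⊢
    simp only [WithLp.smul_fst, WithLp.smul_snd, PiLp.smul_apply, inner_smul_right] at h1 ⊢
    rw [h1]
    ring

theorem isClosed_weightedGraph (κ : ℝ) : IsClosed {U : JetSpace | U ∈ weightedGraph κ} := by
  have : {U : JetSpace | U ∈ weightedGraph κ} =
      ⋂ (ψ : Plane → ℂ) (_ : IsTestFunction ψ) (j : Fin 2),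
        {U | ∫ x in unitDisk, U.fst x * partialDeriv j ψ x =
          - ∫ x in unitDisk, ((κ : ℂ) • U.snd j : L2Disk) x * ψ x} := by
    ext U
    simp only [Set.mem_iInter]
    rfl
  rw [this]
  refine isClosed_iInter fun ψ => isClosed_iInter fun hψ => isClosed_iInter fun j => ?_
  simp only [integral_mul_eq_inner
    (contDiff_partialDeriv (m := 0) j hψ.1 (by simp)).continuous,
    integral_mul_eq_inner hψ.1.continuous]
  refine isClosed_eq ?_ ?_
  · exact Continuous.inner continuous_const (WithLp.continuous_fst 2 _ _)
  · have h : Continuous fun U : JetSpace => U.snd j :=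
      (PiLp.continuous_apply 2 (fun _ : Fin 2 => L2Disk) j).comp (WithLp.continuous_snd 2 _ _)
    exact (Continuous.inner continuous_const (h.const_smul (κ : ℂ))).neg

/-- The Sobolev space `H¹` of the unit disk. A function `u` with weak gradient `∇u` is represented
by the pair `(u, κ⁻¹ ∇u)`, so that the inner product which `H1 κ` inherits from the Hilbert sum
`L² ⊕ (L² ⊕ L²)` is `(u, v) + κ⁻² (∇u, ∇v)`; see `inner_H1`. -/
def H1 (κ : ℝ) : Type := weightedGraph κ

instance (κ : ℝ) : NormedAddCommGroup (H1 κ) :=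
  inferInstanceAs (NormedAddCommGroup (weightedGraph κ))

instance (κ : ℝ) : InnerProductSpace ℂ (H1 κ) :=
  inferInstanceAs (InnerProductSpace ℂ (weightedGraph κ))

instance (κ : ℝ) : CompleteSpace (H1 κ) :=
  (isClosed_weightedGraph κ).completeSpace_coe

/-- The underlying `L²` function of an element of `H¹`. -/
def H1.toL2 {κ : ℝ} (U : H1 κ) : L2Disk := U.1.fst

/-- The weak gradient of an element of `H¹`. -/
def H1.grad {κ : ℝ} (U : H1 κ) (j : Fin 2) : L2Disk := (κ : ℂ) • U.1.snd j

theorem H1.hasWeakGradient {κ : ℝ} (U : H1 κ) : HasWeakGradient U.toL2 U.grad := U.2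

/-- The inner product of `H1 κ` is the `κ`-dependent one. (In Mathlib, `inner ℂ u v` is
conjugate linear in `u`: it is `(v, u)` for a scalar product linear in its first argument.) -/
theorem inner_H1 {κ : ℝ} (hκ : 0 < κ) (U V : H1 κ) :
    inner ℂ U V = (∫ x in unitDisk, V.toL2 x * (starRingEnd ℂ) (U.toL2 x)) +
      ((κ : ℂ) ^ 2)⁻¹ * ∑ j, ∫ x in unitDisk, V.grad j x * (starRingEnd ℂ) (U.grad j x) := by
  have hκ' : (κ : ℂ) ≠ 0 := by exact_mod_cast hκ.ne'
  have key : ∀ f g : L2Disk,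
      ∫ x in unitDisk, g x * (starRingEnd ℂ) (f x) = inner ℂ f g := by
    intro f g
    rw [L2.inner_def]
    rfl
  have h0 : inner ℂ U V = inner ℂ U.1.fst V.1.fst + inner ℂ U.1.snd V.1.snd := rfl
  rw [h0, PiLp.inner_apply]
  simp only [key, H1.toL2, H1.grad, inner_smul_left, inner_smul_right, Complex.conj_ofReal,
    Finset.mul_sum]
  congr 1
  refine Finset.sum_congr rfl fun j _ => ?_
  field_simp

theorem hasWeakGradient_of_contDiff {f : Plane → ℂ} (hf : ContDiff ℝ 1 f) :
    HasWeakGradient ((memLp_of_continuous hf.continuous).toLp f) (fun j =>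
      (memLp_of_continuous
        (contDiff_partialDeriv (m := 0) j hf (by simp)).continuous).toLp (partialDeriv j f)) := by
  intro ψ hψ j
  have cf' := (contDiff_partialDeriv (m := 0) j hf (by simp)).continuous
  have cψ' := (contDiff_partialDeriv (m := 0) j hψ.1 (by simp)).continuous
  have cψ := hψ.1.continuous
  have sψ' : Function.support (partialDeriv j ψ) ⊆ tsupport ψ := by
    intro x hx
    by_contra h
    apply hx
    have : fderiv ℝ ψ x = 0 :=
      image_eq_zero_of_notMem_tsupport (fun h' => h (tsupport_fderiv_subset ℝ h'))
    simp [partialDeriv, this]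
  have kψ' : HasCompactSupport (partialDeriv j ψ) := hψ.2.1.mono' sψ'
  have e1 : ∫ x in unitDisk, (memLp_of_continuous hf.continuous).toLp f x * partialDeriv j ψ x =
      ∫ x, f x * partialDeriv j ψ x := by
    rw [← setIntegral_eq_integral_of_forall_compl_eq_zero (s := unitDisk) (μ := volume)]
    · refine integral_congr_ae ?_
      filter_upwards [(memLp_of_continuous hf.continuous).coeFn_toLp] with x hx
      rw [hx]
    · intro x hx
      have : partialDeriv j ψ x = 0 := by
        by_contra h
        exact hx (hψ.2.2 (sψ' h))
      simp [this]
  have e2 : ∫ x in unitDisk, (memLp_of_continuous cf').toLp (partialDeriv j f) x * ψ x =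
      ∫ x, partialDeriv j f x * ψ x := by
    rw [← setIntegral_eq_integral_of_forall_compl_eq_zero (s := unitDisk) (μ := volume)]
    · refine integral_congr_ae ?_
      filter_upwards [(memLp_of_continuous cf').coeFn_toLp] with x hx
      rw [hx]
    · intro x hx
      have : ψ x = 0 := image_eq_zero_of_notMem_tsupport (fun h => hx (hψ.2.2 h))
      simp [this]
  rw [e1, e2]
  refine integral_mul_fderiv_eq_neg_fderiv_mul_of_integrable ?_ ?_ ?_
    (fun x _ => hf.differentiable (by simp) x) (fun x _ => hψ.1.differentiable (by simp) x)
  · exact (cf'.mul cψ).integrable_of_hasCompactSupport hψ.2.1.mul_left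
  · exact (hf.continuous.mul cψ').integrable_of_hasCompactSupport kψ'.mul_left
  · exact (hf.continuous.mul cψ).integrable_of_hasCompactSupport hψ.2.1.mul_left

/-- The restriction to the unit disk of a `C¹` function on the plane, as an element of `H¹`. -/
def H1.ofContDiff {κ : ℝ} (hκ : 0 < κ) (f : Plane → ℂ) (hf : ContDiff ℝ 1 f) : H1 κ :=
  ⟨WithLp.toLp 2 ((memLp_of_continuous hf.continuous).toLp f,
    WithLp.toLp 2 fun j => (κ : ℂ)⁻¹ • (memLp_of_continuous
      (contDiff_partialDeriv (m := 0) j hf (by simp)).continuous).toLp (partialDeriv j f)), by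
    have hκ' : (κ : ℂ) ≠ 0 := by exact_mod_cast hκ.ne'
    change HasWeakGradient _ _
    simpa [smul_smul, hκ'] using hasWeakGradient_of_contDiff hf⟩

theorem H1.toL2_ofContDiff {κ : ℝ} (hκ : 0 < κ) (f : Plane → ℂ) (hf : ContDiff ℝ 1 f) :
    (H1.ofContDiff hκ f hf).toL2 =ᵐ[diskMeasure] f :=
  (memLp_of_continuous hf.continuous).coeFn_toLp

/-! ## Circular waves -/

/-- The Bessel function of the first kind `J_p` of integer order,
`J_p(t) = (t/2)^p ∑ₖ (-t²/4)^k / (k! Γ(p+k+1))`. The terms with `p + k + 1 ≤ 0`, where `1/Γ`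
vanishes, are zero because `Complex.Gamma` has the value `0` at its poles. -/
def besselJ (p : ℤ) (t : ℝ) : ℂ :=
  ((t : ℂ) / 2) ^ p *
    ∑' k : ℕ, (-((t : ℂ) ^ 2 / 4)) ^ k / ((k.factorial : ℂ) * Complex.Gamma ((p : ℂ) + k + 1))

/-- The point `x = (x₀, x₁)` of the plane as the complex number `x₀ + i x₁`. -/
def toComplex (x : Plane) : ℂ := ⟨x 0, x 1⟩

/-- The circular wave `x = (r, θ) ↦ J_p(κ r) e^{ipθ}`. -/
def circularWaveFun (κ : ℝ) (p : ℤ) (x : Plane) : ℂ :=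
  besselJ p (κ * ‖x‖) * Complex.exp (Complex.I * p * (Complex.arg (toComplex x) : ℂ))

/-- The entire function `t ↦ ∑ₖ (-t)^k / (k! (n+k)!)`. -/
def besselSeries (n : ℕ) (t : ℂ) : ℂ :=
  ∑' k : ℕ, (-t) ^ k / ((k.factorial : ℂ) * ((n + k).factorial : ℂ))

theorem differentiable_besselSeries (n : ℕ) : Differentiable ℂ (besselSeries n) := by
  intro t
  have : DifferentiableOn ℂ (besselSeries n) (Metric.ball 0 (‖t‖ + 1)) := by
    refine Complex.differentiableOn_tsum_of_summable_norm
      (u := fun k : ℕ => (‖t‖ + 1) ^ k / (k.factorial : ℝ))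
      (Real.summable_pow_div_factorial _) (fun k => ?_) Metric.isOpen_ball (fun k w hw => ?_)
    · exact Differentiable.differentiableOn (by fun_prop)
    · have hw' : ‖w‖ ≤ ‖t‖ + 1 := by simpa using (Metric.mem_ball.1 hw).le
      have h1 : (1 : ℝ) ≤ ((n + k).factorial : ℝ) := by exact_mod_cast Nat.factorial_pos _
      have h2 : (0 : ℝ) < (k.factorial : ℝ) := by exact_mod_cast Nat.factorial_pos _
      simp only [norm_div, norm_pow, norm_neg, norm_mul, Complex.norm_natCast]
      gcongr
      nlinarith
  exact (this t (by simp)).differentiableAt (Metric.isOpen_ball.mem_nhds (by simp))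

theorem besselJ_natCast (n : ℕ) (t : ℝ) :
    besselJ n t = ((t : ℂ) / 2) ^ n * besselSeries n ((t : ℂ) ^ 2 / 4) := by
  unfold besselJ besselSeries
  rw [zpow_natCast]
  congr 1
  refine tsum_congr fun k => ?_
  have : (((n : ℤ) : ℂ) + k + 1) = ((n + k : ℕ) : ℂ) + 1 := by push_cast; ring
  rw [this, Complex.Gamma_nat_eq_factorial]

theorem besselJ_neg_natCast (n : ℕ) (t : ℝ) :
    besselJ (-(n : ℤ)) t = (-1) ^ n * besselJ n t := by
  rcases eq_or_ne t 0 with rfl | ht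
  · rcases Nat.eq_zero_or_pos n with rfl | hn
    · simp
    · have h0 : ((n : ℤ)) ≠ 0 := by omega
      simp [besselJ, zero_zpow _ h0]
  · rw [besselJ_natCast]
    have ht' : ((t : ℂ) / 2) ≠ 0 := by simpa using ht
    have hs : ∑' k : ℕ, (-((t : ℂ) ^ 2 / 4)) ^ k /
          ((k.factorial : ℂ) * Complex.Gamma (((-(n : ℤ) : ℤ) : ℂ) + k + 1)) =
        (-((t : ℂ) ^ 2 / 4)) ^ n * besselSeries n ((t : ℂ) ^ 2 / 4) := by
      have hsupp : Function.support (fun k : ℕ => (-((t : ℂ) ^ 2 / 4)) ^ k /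
          ((k.factorial : ℂ) * Complex.Gamma (((-(n : ℤ) : ℤ) : ℂ) + k + 1))) ⊆
          Set.range (fun k : ℕ => k + n) := by
        intro k hk
        by_contra h
        apply hk
        have hkn : k < n := by
          by_contra h'
          exact h ⟨k - n, Nat.sub_add_cancel (not_lt.1 h')⟩
        have : (((-(n : ℤ) : ℤ) : ℂ) + k + 1) = -((n - k - 1 : ℕ) : ℂ) := by
          rw [Nat.cast_sub (by omega), Nat.cast_sub hkn.le]
          push_cast; ring
        simp only [this, Complex.Gamma_neg_nat_eq_zero, mul_zero, div_zero]
      rw [← (add_left_injective n).tsum_eq hsupp]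
      unfold besselSeries
      rw [← tsum_mul_left]
      refine tsum_congr fun k => ?_
      have : (((-(n : ℤ) : ℤ) : ℂ) + ((k + n : ℕ) : ℂ) + 1) = (k : ℂ) + 1 := by
        push_cast; ring
      rw [this, Complex.Gamma_nat_eq_factorial, pow_add, add_comm n k]
      ring
    rw [besselJ, hs, zpow_neg, zpow_natCast]
    have : (-((t : ℂ) ^ 2 / 4)) ^ n = (-1) ^ n * ((t : ℂ) / 2) ^ n * ((t : ℂ) / 2) ^ n := by
      rw [← mul_pow, ← mul_pow]; congr 1; ring
    rw [this]
    field_simp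

theorem norm_toComplex (x : Plane) : ‖toComplex x‖ = ‖x‖ := by
  rw [Complex.norm_def, EuclideanSpace.norm_eq]
  simp [toComplex, Complex.normSq_apply, Fin.sum_univ_two, sq]

theorem contDiff_toComplex {n : WithTop ℕ∞} : ContDiff ℝ n toComplex := by
  have : toComplex = fun x : Plane => ((x 0 : ℝ) : ℂ) + ((x 1 : ℝ) : ℂ) * Complex.I := by
    funext x
    exact (Complex.mk_eq_add_mul_I _ _)
  rw [this]
  have h (j : Fin 2) : ContDiff ℝ n fun x : Plane => ((x j : ℝ) : ℂ) :=
    Complex.ofRealCLM.contDiff.comp (by fun_prop)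
  exact (h 0).add ((h 1).mul contDiff_const)

theorem circularWaveFun_natCast (κ : ℝ) (n : ℕ) :
    circularWaveFun κ n = fun x => ((κ : ℂ) / 2) ^ n * toComplex x ^ n *
      besselSeries n (((κ ^ 2 * ‖x‖ ^ 2 / 4 : ℝ)) : ℂ) := by
  funext x
  have hz : toComplex x ^ n =
      (‖x‖ : ℂ) ^ n * Complex.exp (Complex.I * n * (Complex.arg (toComplex x) : ℂ)) := by
    conv_lhs => rw [← Complex.norm_mul_exp_arg_mul_I (toComplex x)]
    rw [mul_pow, ← Complex.exp_nat_mul, norm_toComplex]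
    congr 2
    ring
  rw [circularWaveFun, besselJ_natCast, hz]
  push_cast
  rw [show ((κ : ℂ) * ‖x‖) ^ 2 = (κ : ℂ) ^ 2 * (‖x‖ : ℂ) ^ 2 by ring,
    show ((κ : ℂ) * ‖x‖ / 2) ^ n = ((κ : ℂ) / 2) ^ n * (‖x‖ : ℂ) ^ n by rw [← mul_pow]; ring]
  ring

theorem circularWaveFun_neg_natCast (κ : ℝ) (n : ℕ) :
    circularWaveFun κ (-(n : ℤ)) = fun x => (-1) ^ n * (((κ : ℂ) / 2) ^ n *
      (starRingEnd ℂ) (toComplex x) ^ n * besselSeries n (((κ ^ 2 * ‖x‖ ^ 2 / 4 : ℝ)) : ℂ)) := by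
  funext x
  have hz : (starRingEnd ℂ) (toComplex x) ^ n = (‖x‖ : ℂ) ^ n *
      Complex.exp (Complex.I * ((-(n : ℤ) : ℤ) : ℂ) * (Complex.arg (toComplex x) : ℂ)) := by
    conv_lhs => rw [← Complex.norm_mul_exp_arg_mul_I (toComplex x)]
    rw [map_mul, ← Complex.exp_conj, mul_pow, ← Complex.exp_nat_mul, norm_toComplex]
    simp only [map_mul, Complex.conj_ofReal, Complex.conj_I]
    congr 2
    push_cast
    ring
  rw [circularWaveFun, besselJ_neg_natCast, besselJ_natCast, hz]
  push_cast
  rw [show ((κ : ℂ) * ‖x‖) ^ 2 = (κ : ℂ) ^ 2 * (‖x‖ : ℂ) ^ 2 by ring,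
    show ((κ : ℂ) * ‖x‖ / 2) ^ n = ((κ : ℂ) / 2) ^ n * (‖x‖ : ℂ) ^ n by rw [← mul_pow]; ring]
  ring

theorem contDiff_circularWaveFun (κ : ℝ) (p : ℤ) : ContDiff ℝ 1 (circularWaveFun κ p) := by
  have hS (n : ℕ) :
      ContDiff ℝ 1 fun x : Plane => besselSeries n (((κ ^ 2 * ‖x‖ ^ 2 / 4 : ℝ)) : ℂ) := by
    have h1 : ContDiff ℝ 1 (besselSeries n) :=
      (differentiable_besselSeries n).contDiff.restrict_scalars ℝ
    refine h1.comp (Complex.ofRealCLM.contDiff.comp ?_)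
    exact (contDiff_const.mul (contDiff_norm_sq ℝ)).div_const _
  obtain ⟨n, rfl | rfl⟩ := p.eq_nat_or_neg
  · rw [circularWaveFun_natCast]
    exact (contDiff_const.mul (contDiff_toComplex.pow n)).mul (hS n)
  · rw [circularWaveFun_neg_natCast]
    exact contDiff_const.mul ((contDiff_const.mul
      ((Complex.conjCLE.contDiff.comp contDiff_toComplex).pow n)).mul (hS n))

variable {κ : ℝ}

/-- The circular wave `b̃_p` as an element of `H¹`. -/
def circularWave (hκ : 0 < κ) (p : ℤ) : H1 κ :=
  H1.ofContDiff hκ (circularWaveFun κ p) (contDiff_circularWaveFun κ p)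

/-- The normalization coefficient `β_p = ‖b̃_p‖⁻¹`. -/
def beta (hκ : 0 < κ) (p : ℤ) : ℝ := ‖circularWave hκ p‖⁻¹

/-- The normalized circular wave `b_p = β_p b̃_p`. -/
def normalizedWave (hκ : 0 < κ) (p : ℤ) : H1 κ := (beta hκ p : ℂ) • circularWave hκ p

/-- The space `ℬ`: the closure of the span of the circular waves in `H¹`. -/
def spaceB (hκ : 0 < κ) : Submodule ℂ (H1 κ) :=
  (Submodule.span ℂ (Set.range (normalizedWave hκ))).topologicalClosure

instance (hκ : 0 < κ) : CompleteSpace (spaceB hκ) :=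
  (Submodule.isClosed_topologicalClosure _).completeSpace_coe

/-! ## Evanescent plane waves -/

/-- The cylinder `Y = [0, 2π) × ℝ`, with points `y = (φ, ζ)`. -/
abbrev Cylinder : Type := Set.Ico (0 : ℝ) (2 * Real.pi) × ℝ

/-- The complex angle `φ + iζ` of the point `y = (φ, ζ)`. -/
def complexAngle (y : Cylinder) : ℂ := ((y.1 : ℝ) : ℂ) + Complex.I * (y.2 : ℂ)

/-- The evanescent plane wave `φ_y(x) = e^{iκ d(y)·x}`, where
`d(y) = (cos(φ + iζ), sin(φ + iζ))`. -/
def planeWaveFun (κ : ℝ) (y : Cylinder) (x : Plane) : ℂ :=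
  Complex.exp (Complex.I * κ *
    (Complex.cos (complexAngle y) * (x 0 : ℂ) + Complex.sin (complexAngle y) * (x 1 : ℂ)))

theorem contDiff_planeWaveFun (κ : ℝ) (y : Cylinder) : ContDiff ℝ 1 (planeWaveFun κ y) := by
  have h (j : Fin 2) : ContDiff ℝ 1 fun x : Plane => ((x j : ℝ) : ℂ) :=
    Complex.ofRealCLM.contDiff.comp (by fun_prop)
  exact (contDiff_const.mul
    ((contDiff_const.mul (h 0)).add (contDiff_const.mul (h 1)))).cexp

/-- The evanescent plane wave `φ_y`, restricted to the unit disk, as an element of `H¹`. -/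
def planeWave (hκ : 0 < κ) (y : Cylinder) : H1 κ :=
  H1.ofContDiff hκ (planeWaveFun κ y) (contDiff_planeWaveFun κ y)

/-! ## The weighted `L²` space on the cylinder and the numbers `τ_p` -/

/-- The weight `w_z(y) = e^{-κ sinh|ζ| + z|ζ|}`. -/
def weightZ (κ z : ℝ) (y : Cylinder) : ℝ :=
  Real.exp (-κ * Real.sinh |y.2| + z * |y.2|)

/-- The weight `w = w_{1/4}`. -/
def weight (κ : ℝ) (y : Cylinder) : ℝ := weightZ κ (1 / 4) y

/-- The Lebesgue measure `dy` on the cylinder. -/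
def lebesgueCylinder : Measure Cylinder :=
  (Measure.comap Subtype.val (volume : Measure ℝ)).prod volume

/-- The measure `w² dy` on the cylinder. -/
def cylinderMeasure (κ : ℝ) : Measure Cylinder :=
  lebesgueCylinder.withDensity fun y => ENNReal.ofReal (weight κ y ^ 2)

/-- The norm `‖v‖ = (∫_Y |v|² w² dy)^{1/2}` on densities on the cylinder. -/
def normA (κ : ℝ) (v : Cylinder → ℂ) : ℝ :=
  Real.sqrt (∫ y, ‖v y‖ ^ 2 ∂(cylinderMeasure κ))

/-- The Herglotz polynomial `ã_p(φ, ζ) = e^{pζ} e^{ipφ}`. -/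
def herglotzPolynomial (p : ℤ) (y : Cylinder) : ℂ :=
  Complex.exp ((p : ℂ) * (y.2 : ℂ)) * Complex.exp (Complex.I * p * ((y.1 : ℝ) : ℂ))

/-- The normalization coefficient `α_p = ‖ã_p‖⁻¹`. -/
def alpha (κ : ℝ) (p : ℤ) : ℝ := (normA κ (herglotzPolynomial p))⁻¹

/-- `τ_p = i^p (α_p β_p)⁻¹`. -/
def tau (hκ : 0 < κ) (p : ℤ) : ℂ :=
  Complex.I ^ p * ((alpha κ p * beta hκ p : ℝ) : ℂ)⁻¹

/-- `τ₋ = inf_p |τ_p|`. -/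
def tauMinus (hκ : 0 < κ) : ℝ := ⨅ p : ℤ, ‖tau hκ p‖

/-- `τ₊ = sup_p |τ_p|`. -/
def tauPlus (hκ : 0 < κ) : ℝ := ⨆ p : ℤ, ‖tau hκ p‖

/-! ## Continuous frames -/

section Frame

variable {H : Type*} [NormedAddCommGroup H] [InnerProductSpace ℂ H]
  {M : Type*} [MeasurableSpace M]

/-- `A > 0` is a lower frame bound: `A ‖u‖² ≤ ∫ |(u, f_k)|² dμ(k)` for all `u`. -/
def IsLowerFrameBound (μ : Measure M) (f : M → H) (A : ℝ) : Prop :=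
  0 < A ∧ ∀ u : H, ENNReal.ofReal (A * ‖u‖ ^ 2) ≤ ∫⁻ k, ‖inner ℂ (f k) u‖ₑ ^ 2 ∂μ

/-- `B > 0` is an upper frame bound: `∫ |(u, f_k)|² dμ(k) ≤ B ‖u‖²` for all `u`. -/
def IsUpperFrameBound (μ : Measure M) (f : M → H) (B : ℝ) : Prop :=
  0 < B ∧ ∀ u : H, ∫⁻ k, ‖inner ℂ (f k) u‖ₑ ^ 2 ∂μ ≤ ENNReal.ofReal (B * ‖u‖ ^ 2)

/-- A continuous frame for a complex Hilbert space `H` with respect to a measure `μ`. -/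
def IsContinuousFrame [CompleteSpace H] (μ : Measure M) (f : M → H) : Prop :=
  (∀ u : H, Measurable fun k => inner ℂ (f k) u) ∧
    (∃ A, IsLowerFrameBound μ f A) ∧ ∃ B, IsUpperFrameBound μ f B

end Frame

end Helmholtz

end

noncomputable section

namespace Helmholtz

/-! ## The Bessel series -/

/-! The frame operator is diagonal. The Jacobi–Anger expansion of an evanescent plane wave converges
in `H¹` and reads `φ_y = ∑ₚ τ_p conj(a_p(y)) b_p`, where `a_p = α_p ã_p` (`hasSum_normalizedWave`).
The `b_p` form a Hilbert basis of `ℬ`, being orthogonal by rotation invariance and total by the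
definition of `ℬ`; the `a_p` are orthonormal in `L²(w² dy)`. Hence `(u, φ_y) = ∑ₚ conj(τ_p) (u, b_p)
a_p(y)`, and `∫ |(u, φ_y)|² w² dy = ∑ₚ |τ_p|² |(u, b_p)|²` (`lintegral_enorm_inner_sq`). Comparison
with `‖u‖² = ∑ₚ |(u, b_p)|²` gives the frame bounds, and `u = b_q` shows that they are optimal
(`isContinuousFrame_of_hasSum`). Completeness of the `a_p` is not needed.

What remains is analytic: `|τ_p| = ‖ã_p‖ ‖b̃_p‖` must stay between positive constants. Each `|τ_p|`
is positive and depends only on `|p|`, so only large orders `n` matter. The first term of the Bessel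
series dominates there, so `‖b̃_n‖²` is comparable to `(κ/2)^{2n} n / n!²`
(`exists_bounds_norm_sq_circularWave`). The substitution `t = e^ζ` makes `‖ã_n‖²` comparable to
`κ^{-2n} Γ(2n + 1/2)` (`integral_radialWeight_le`, `le_integral_radialWeight`). The powers of `κ`
cancel in the product, which leaves `Γ(2n + 1/2) n / (4ⁿ n!²)`. The exponent `1/4` in `w`, doubled
in `w²`, is the one for which this quotient neither decays nor grows. Its bounds come from
monotonicity in `n` instead of Stirling's formula (`gammaRatio_bounds`). -/

theorem summable_norm_besselSeries (n : ℕ) (t : ℂ) :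
    Summable fun k : ℕ => ‖(-t) ^ k / ((k.factorial : ℂ) * ((n + k).factorial : ℂ))‖ := by
  refine Summable.of_nonneg_of_le (fun _ => norm_nonneg _) (fun k => ?_)
    (Real.summable_pow_div_factorial ‖t‖)
  have h1 : (1 : ℝ) ≤ ((n + k).factorial : ℝ) := by exact_mod_cast Nat.factorial_pos _
  have h2 : (0 : ℝ) < (k.factorial : ℝ) := by exact_mod_cast Nat.factorial_pos _
  simp only [norm_div, norm_pow, norm_neg, norm_mul, Complex.norm_natCast]
  gcongr
  nlinarith

theorem hasSum_besselSeries (n : ℕ) (t : ℂ) :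
    HasSum (fun k : ℕ => (-t) ^ k / ((k.factorial : ℂ) * ((n + k).factorial : ℂ)))
      (besselSeries n t) :=
  (summable_norm_besselSeries n t).of_norm.hasSum

theorem factorial_cast_succ (n : ℕ) :
    ((n + 1).factorial : ℂ) = ((n : ℂ) + 1) * (n.factorial : ℂ) := by
  rw [Nat.factorial_succ]; push_cast; ring

theorem factorial_cast_ne_zero (n : ℕ) : (n.factorial : ℂ) ≠ 0 := by
  exact_mod_cast n.factorial_ne_zero

/-- The term `k = 0` vanishes and `k / k! = 1 / (k - 1)!`, so shifting `k` by one raises the order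
by one and releases a factor `-t`. -/
theorem hasSum_natCast_mul_besselSeries (n : ℕ) (t : ℂ) :
    HasSum (fun k : ℕ => (k : ℂ) * ((-t) ^ k / ((k.factorial : ℂ) * ((n + k).factorial : ℂ))))
      (-t * besselSeries (n + 1) t) := by
  refine (hasSum_nat_add_iff' 1).1 ?_
  simp only [Finset.range_one, Finset.sum_singleton, Nat.cast_zero, zero_mul, sub_zero]
  refine ((hasSum_besselSeries (n + 1) t).mul_left (-t)).congr_fun fun k => ?_
  rw [show n + (k + 1) = n + 1 + k by ring, factorial_cast_succ k]
  have h1 := factorial_cast_ne_zero k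
  have h2 := factorial_cast_ne_zero (n + 1 + k)
  have h3 : (k : ℂ) + 1 ≠ 0 := by exact_mod_cast k.succ_ne_zero
  push_cast
  field_simp
  ring

/-- The recurrence relation `(n + 1) S_{n+1}(t) - t S_{n+2}(t) = S_n(t)`. -/
theorem besselSeries_recurrence (n : ℕ) (t : ℂ) :
    ((n : ℂ) + 1) * besselSeries (n + 1) t - t * besselSeries (n + 2) t = besselSeries n t := by
  -- The two series add up to one with the factor `n + 1 + k`, which turns `(n + 1 + k)!` into `(n +
  -- k)!`.
  have h := ((hasSum_besselSeries (n + 1) t).mul_left ((n : ℂ) + 1)).add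
    (hasSum_natCast_mul_besselSeries (n + 1) t)
  refine HasSum.unique ?_ (hasSum_besselSeries n t)
  rw [sub_eq_add_neg, ← neg_mul]
  refine h.congr_fun fun k => ?_
  rw [show n + 1 + k = n + k + 1 by ring, factorial_cast_succ (n + k)]
  have h1 := factorial_cast_ne_zero k
  have h2 := factorial_cast_ne_zero (n + k)
  have h3 : (n : ℂ) + k + 1 ≠ 0 := by exact_mod_cast (n + k).succ_ne_zero
  push_cast
  field_simp
  ring

theorem hasDerivAt_besselSeries (n : ℕ) (t : ℂ) :
    HasDerivAt (besselSeries n) (-besselSeries (n + 1) t) t := by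
  have h := Complex.hasSum_deriv_of_summable_norm (z := t) (U := Metric.ball 0 (‖t‖ + 1))
    (F := fun (k : ℕ) (s : ℂ) => (-s) ^ k / ((k.factorial : ℂ) * ((n + k).factorial : ℂ)))
    (Real.summable_pow_div_factorial (‖t‖ + 1))
    (fun k => Differentiable.differentiableOn (by fun_prop)) Metric.isOpen_ball
    (fun k w hw => by
      have hw' : ‖w‖ ≤ ‖t‖ + 1 := by simpa using (Metric.mem_ball.1 hw).le
      have h1 : (1 : ℝ) ≤ ((n + k).factorial : ℝ) := by exact_mod_cast Nat.factorial_pos _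
      have h2 : (0 : ℝ) < (k.factorial : ℝ) := by exact_mod_cast Nat.factorial_pos _
      simp only [norm_div, norm_pow, norm_neg, norm_mul, Complex.norm_natCast]
      gcongr
      nlinarith) (by simp)
  have hd : deriv (besselSeries n) t = -besselSeries (n + 1) t := by
    refine HasSum.unique h ?_
    refine (hasSum_nat_add_iff' 1).1 ?_
    have h0 (k : ℕ) : deriv (fun s : ℂ => (-s) ^ k / ((k.factorial : ℂ) *
        ((n + k).factorial : ℂ))) t =
        -((k : ℂ) * (-t) ^ (k - 1)) / ((k.factorial : ℂ) * ((n + k).factorial : ℂ)) := by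
      refine HasDerivAt.deriv ?_
      have := ((hasDerivAt_id t).neg.pow k).div_const
        ((k.factorial : ℂ) * ((n + k).factorial : ℂ))
      exact this.congr_deriv (by simp)
    simp only [h0, Finset.range_one, Finset.sum_singleton, Nat.cast_zero, zero_mul, neg_zero,
      zero_div, sub_zero]
    refine (hasSum_besselSeries (n + 1) t).neg.congr_fun fun k => ?_
    rw [show n + (k + 1) = n + 1 + k by ring, factorial_cast_succ k, Nat.add_sub_cancel]
    have h1 := factorial_cast_ne_zero k
    have h2 := factorial_cast_ne_zero (n + 1 + k)
    have h3 : (k : ℂ) + 1 ≠ 0 := by exact_mod_cast k.succ_ne_zero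
    push_cast
    field_simp
  rw [← hd]
  exact (differentiable_besselSeries n t).hasDerivAt

/-- Since `n! (n + 1)^k ≤ (n + k)!`, the terms with `k ≥ 1` are dominated by those of the
exponential series at `‖t‖ / (n + 1)`. The bound tends to zero as `n` grows, so the first term gives
the size of the series. -/
theorem norm_factorial_mul_besselSeries_sub_one_le (n : ℕ) (t : ℂ) :
    ‖(n.factorial : ℂ) * besselSeries n t - 1‖ ≤ Real.exp (‖t‖ / (n + 1)) - 1 := by
  have h1 := (hasSum_nat_add_iff' 1).2 ((hasSum_besselSeries n t).mul_left (n.factorial : ℂ))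
  have h2 : HasSum (fun k : ℕ => (‖t‖ / (n + 1)) ^ (k + 1) / ((k + 1).factorial : ℝ))
      (Real.exp (‖t‖ / (n + 1)) - 1) := by
    have := (hasSum_nat_add_iff' 1).2
      (NormedSpace.expSeries_div_hasSum_exp (‖t‖ / ((n : ℝ) + 1)))
    simpa [← Real.exp_eq_exp_ℝ] using this
  have h0 := factorial_cast_ne_zero n
  simp only [Finset.range_one, Finset.sum_singleton, pow_zero, Nat.factorial_zero, Nat.cast_one,
    add_zero, one_mul, mul_one_div_cancel h0] at h1
  refine h1.norm_le_of_bounded h2 fun k => ?_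
  have h3 : (n.factorial : ℝ) * ((n : ℝ) + 1) ^ (k + 1) ≤ ((n + (k + 1)).factorial : ℝ) := by
    exact_mod_cast Nat.factorial_mul_pow_le_factorial
  have h4 : (0 : ℝ) < ((k + 1).factorial : ℝ) := by exact_mod_cast Nat.factorial_pos _
  have h5 : (0 : ℝ) < (n.factorial : ℝ) := by exact_mod_cast Nat.factorial_pos _
  have h6 : (0 : ℝ) < ((n + (k + 1)).factorial : ℝ) := by exact_mod_cast Nat.factorial_pos _
  have h7 : (0 : ℝ) < (n : ℝ) + 1 := by positivity
  simp only [norm_div, norm_pow, norm_neg, norm_mul, Complex.norm_natCast]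
  rw [div_pow, mul_div_assoc', div_div, div_le_div_iff₀ (by positivity) (by positivity)]
  have h8 : 0 ≤ ‖t‖ ^ (k + 1) := by positivity
  calc _ = ‖t‖ ^ (k + 1) * ((k + 1).factorial : ℝ) *
        ((n.factorial : ℝ) * ((n : ℝ) + 1) ^ (k + 1)) := by ring
    _ ≤ ‖t‖ ^ (k + 1) * ((k + 1).factorial : ℝ) * ((n + (k + 1)).factorial : ℝ) := by gcongr
    _ = _ := by ring

theorem norm_besselSeries_le (n : ℕ) (t : ℂ) :
    ‖besselSeries n t‖ ≤ Real.exp ‖t‖ / n.factorial := by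
  have h5 : (0 : ℝ) < (n.factorial : ℝ) := by exact_mod_cast Nat.factorial_pos _
  rw [le_div_iff₀ h5]
  have h := norm_factorial_mul_besselSeries_sub_one_le n t
  have h1 : ‖(n.factorial : ℂ) * besselSeries n t‖ ≤ Real.exp (‖t‖ / (n + 1)) := by
    have := norm_sub_norm_le ((n.factorial : ℂ) * besselSeries n t) 1
    rw [norm_one] at this
    linarith
  rw [norm_mul, Complex.norm_natCast] at h1
  have h2 : Real.exp (‖t‖ / (n + 1)) ≤ Real.exp ‖t‖ := by
    refine Real.exp_le_exp.2 (div_le_self (norm_nonneg _) ?_)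
    have : (0 : ℝ) ≤ n := n.cast_nonneg
    linarith
  linarith [mul_comm ‖besselSeries n t‖ (n.factorial : ℝ)]

theorem conj_besselSeries_ofReal (n : ℕ) (t : ℝ) :
    (starRingEnd ℂ) (besselSeries n (t : ℂ)) = besselSeries n (t : ℂ) := by
  unfold besselSeries
  rw [Complex.conj_tsum]
  refine tsum_congr fun k => ?_
  simp

/-! ## Pointwise properties of circular waves -/

theorem norm_circularWaveFun_natCast (κ : ℝ) (n : ℕ) (x : Plane) :
    ‖circularWaveFun κ n x‖ =
      (|κ| / 2) ^ n * ‖x‖ ^ n * ‖besselSeries n (((κ ^ 2 * ‖x‖ ^ 2 / 4 : ℝ)) : ℂ)‖ := by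
  rw [circularWaveFun_natCast]
  simp [norm_toComplex]

theorem circularWaveFun_neg (κ : ℝ) (p : ℤ) (x : Plane) :
    circularWaveFun κ (-p) x = (-1) ^ p * (starRingEnd ℂ) (circularWaveFun κ p x) := by
  have key (n : ℕ) : circularWaveFun κ (-(n : ℤ)) x =
      (-1) ^ n * (starRingEnd ℂ) (circularWaveFun κ n x) := by
    rw [circularWaveFun_neg_natCast, circularWaveFun_natCast]
    simp only [map_mul, map_pow, conj_besselSeries_ofReal, map_div₀, Complex.conj_ofReal,
      Complex.conj_ofNat]
  obtain ⟨n, rfl | rfl⟩ := p.eq_nat_or_neg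
  · rw [key, zpow_natCast]
  · rw [key, neg_neg, zpow_neg, zpow_natCast, map_mul, Complex.conj_conj, ← mul_assoc]
    simp

theorem norm_circularWaveFun_neg (κ : ℝ) (p : ℤ) (x : Plane) :
    ‖circularWaveFun κ (-p) x‖ = ‖circularWaveFun κ p x‖ := by
  rw [circularWaveFun_neg]
  simp

theorem norm_circularWaveFun_natAbs (κ : ℝ) (p : ℤ) (x : Plane) :
    ‖circularWaveFun κ p x‖ = ‖circularWaveFun κ (p.natAbs : ℤ) x‖ := by
  rcases Int.natAbs_eq p with h | h
  · rw [← h]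
  · conv_lhs => rw [h]
    exact norm_circularWaveFun_neg _ _ _

/-- The coordinate vectors of the plane as complex numbers. -/
def unitDir : Fin 2 → ℂ := ![1, Complex.I]

theorem toComplex_add_smul_single (x : Plane) (j : Fin 2) (s : ℝ) :
    toComplex (x + s • EuclideanSpace.single j 1) = toComplex x + s * unitDir j := by
  fin_cases j <;> apply Complex.ext <;> simp [toComplex, unitDir]

theorem ofReal_norm_sq (x : Plane) :
    ((‖x‖ : ℂ)) ^ 2 = toComplex x * (starRingEnd ℂ) (toComplex x) := by
  rw [Complex.mul_conj, Complex.normSq_eq_norm_sq, norm_toComplex]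
  push_cast
  rfl

theorem partialDeriv_eq_of_hasDerivAt {f : Plane → ℂ} (hf : ContDiff ℝ 1 f) {j : Fin 2}
    {x : Plane} {c : ℂ}
    (h : HasDerivAt (fun s : ℝ => f (x + s • EuclideanSpace.single j 1)) c 0) :
    partialDeriv j f x = c := by
  have hd : DifferentiableAt ℝ f x := hf.differentiable (by simp) x
  rw [partialDeriv, ← hd.lineDeriv_eq_fderiv]
  exact h.deriv

/-- Differentiation only shifts the order by one up or down. This reduces every `H¹` computation
with circular waves to an `L²` computation with the neighbouring orders. -/
theorem partialDeriv_circularWaveFun_natCast (κ : ℝ) (n : ℕ) (j : Fin 2) (x : Plane) :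
    partialDeriv j (circularWaveFun κ n) x = (κ : ℂ) / 2 *
      (unitDir j * circularWaveFun κ (n - 1) x -
        (starRingEnd ℂ) (unitDir j) * circularWaveFun κ (n + 1) x) := by
  refine partialDeriv_eq_of_hasDerivAt (contDiff_circularWaveFun κ n) ?_
  set z := toComplex x with hz
  set d := unitDir j with hd
  set t : ℂ := (κ : ℂ) ^ 2 / 4 * (z * (starRingEnd ℂ) z) with ht
  -- The real parameter is made complex: `z` and its conjugate move along two separate affine lines,
  -- so the restricted wave is holomorphic in `s` and the complex chain rule applies.
  have hu : HasDerivAt (fun s : ℂ => z + s * d) d 0 := by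
    simpa using ((hasDerivAt_id (0 : ℂ)).mul_const d).const_add z
  have hv : HasDerivAt (fun s : ℂ => (starRingEnd ℂ) z + s * (starRingEnd ℂ) d)
      ((starRingEnd ℂ) d) 0 := by
    simpa using ((hasDerivAt_id (0 : ℂ)).mul_const ((starRingEnd ℂ) d)).const_add
      ((starRingEnd ℂ) z)
  have hT := (hu.mul hv).const_mul ((κ : ℂ) ^ 2 / 4)
  have hS := (hasDerivAt_besselSeries n t).comp_of_eq 0 hT (by simp [ht])
  have hG := (((hu.pow n).const_mul (((κ : ℂ) / 2) ^ n)).mul hS)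
  have hR := HasDerivAt.comp_ofReal (z := (0 : ℝ)) (by simpa using hG)
  have hx (y : Plane) : (((κ ^ 2 * ‖y‖ ^ 2 / 4 : ℝ)) : ℂ) =
      (κ : ℂ) ^ 2 / 4 * (toComplex y * (starRingEnd ℂ) (toComplex y)) := by
    rw [← ofReal_norm_sq]; push_cast; ring
  have e : (fun s : ℝ => circularWaveFun κ n (x + s • EuclideanSpace.single j 1)) =
      fun s : ℝ => ((κ : ℂ) / 2) ^ n * (z + s * d) ^ n * besselSeries n ((κ : ℂ) ^ 2 / 4 *
        ((z + s * d) * ((starRingEnd ℂ) z + s * (starRingEnd ℂ) d))) := by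
    funext s
    rw [circularWaveFun_natCast]
    simp only [hx, toComplex_add_smul_single, ← hz, ← hd, map_add, map_mul, Complex.conj_ofReal]
  rw [e]
  have hn1 : circularWaveFun κ (n + 1) x =
      ((κ : ℂ) / 2) ^ (n + 1) * z ^ (n + 1) * besselSeries (n + 1) t := by
    have := circularWaveFun_natCast κ (n + 1)
    push_cast at this
    rw [this]
    simp only [← Complex.ofReal_pow, ← hz]
    rw [ht, ← hx]
    push_cast
    rfl
  refine hR.congr_deriv ?_
  rw [hn1]
  rcases n with _ | n
  -- For `n = 0` the lower neighbour has order `-1` and needs the formula for negative orders.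
  · have hm : circularWaveFun κ (((0 : ℕ) : ℤ) - 1) x =
        -(((κ : ℂ) / 2) * (starRingEnd ℂ) z * besselSeries 1 t) := by
      have := circularWaveFun_neg_natCast κ 1
      rw [show (((0 : ℕ) : ℤ) - 1) = -((1 : ℕ) : ℤ) by norm_num, this]
      simp only [hx, ← hz, ← ht]
      ring
    rw [hm]
    simp
    ring
  · have hm : circularWaveFun κ (((n + 1 : ℕ) : ℤ) - 1) x =
        ((κ : ℂ) / 2) ^ n * z ^ n * besselSeries n t := by
      rw [show (((n + 1 : ℕ) : ℤ) - 1) = (n : ℤ) by push_cast; ring, circularWaveFun_natCast]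
      simp only [hx, ← hz, ← ht]
    -- The series of order `n` is eliminated; both sides then contain only the orders `n + 1` and `n
    -- + 2`.
    rw [hm, ← besselSeries_recurrence n t]
    simp
    ring

theorem partialDeriv_conj {f : Plane → ℂ} (hf : ContDiff ℝ 1 f) (j : Fin 2) (x : Plane) :
    partialDeriv j (fun y => (starRingEnd ℂ) (f y)) x = (starRingEnd ℂ) (partialDeriv j f x) := by
  have hd : HasFDerivAt f (fderiv ℝ f x) x := (hf.differentiable (by simp) x).hasFDerivAt
  have := (Complex.conjCLE.hasFDerivAt (x := f x)).comp x hd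
  have h2 : HasFDerivAt (fun y => (starRingEnd ℂ) (f y)) _ x := this
  rw [partialDeriv, h2.fderiv]
  rfl

theorem partialDeriv_const_mul {f : Plane → ℂ} (hf : ContDiff ℝ 1 f) (c : ℂ) (j : Fin 2)
    (x : Plane) : partialDeriv j (fun y => c * f y) x = c * partialDeriv j f x := by
  have hd : HasFDerivAt f (fderiv ℝ f x) x := (hf.differentiable (by simp) x).hasFDerivAt
  rw [partialDeriv, (hd.const_mul c).fderiv]
  rfl

theorem partialDeriv_circularWaveFun (κ : ℝ) (p : ℤ) (j : Fin 2) (x : Plane) :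
    partialDeriv j (circularWaveFun κ p) x = (κ : ℂ) / 2 *
      (unitDir j * circularWaveFun κ (p - 1) x -
        (starRingEnd ℂ) (unitDir j) * circularWaveFun κ (p + 1) x) := by
  obtain ⟨n, rfl | rfl⟩ := p.eq_nat_or_neg
  · exact partialDeriv_circularWaveFun_natCast κ n j x
  · have e : circularWaveFun κ (-(n : ℤ)) =
        fun y => (-1) ^ (n : ℤ) * (starRingEnd ℂ) (circularWaveFun κ n y) := by
      funext y; exact circularWaveFun_neg κ n y
    have hc : ContDiff ℝ 1 fun y => (starRingEnd ℂ) (circularWaveFun κ n y) :=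
      Complex.conjCLE.contDiff.comp (contDiff_circularWaveFun κ n)
    rw [e, partialDeriv_const_mul hc,
      partialDeriv_conj (contDiff_circularWaveFun κ n), partialDeriv_circularWaveFun_natCast,
      show -(n : ℤ) - 1 = -((n : ℤ) + 1) by ring, show -(n : ℤ) + 1 = -((n : ℤ) - 1) by ring,
      circularWaveFun_neg, circularWaveFun_neg, zpow_add₀ (by norm_num), zpow_sub₀ (by norm_num)]
    simp only [map_mul, map_sub, map_div₀, Complex.conj_ofReal, Complex.conj_conj, map_ofNat,
      zpow_one]
    ring

/-! ## The Jacobi–Anger expansion -/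

/-- Pairs of exponents `(m, n)` as pairs (difference, minimum). -/
def diffMinEquiv : ℕ × ℕ ≃ ℤ × ℕ where
  toFun a := ((a.1 : ℤ) - a.2, min a.1 a.2)
  invFun b := (b.2 + b.1.toNat, b.2 + (-b.1).toNat)
  left_inv a := by ext <;> grind
  right_inv b := by ext <;> grind

/-- A Cauchy product grouped by the difference of the exponents. With exponential series, a fixed
difference `p` collects the terms of a Bessel series of order `|p|`. -/
theorem hasSum_mul_prod {f g : ℕ → ℂ} {s t : ℂ} (hf : HasSum f s) (hg : HasSum g t)
    (hf' : Summable fun n => ‖f n‖) (hg' : Summable fun n => ‖g n‖) :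
    HasSum (fun c : ℤ × ℕ => f (c.2 + c.1.toNat) * g (c.2 + (-c.1).toNat)) (s * t) :=
  diffMinEquiv.symm.hasSum_iff.2 (hf.mul hg (summable_mul_of_summable_norm hf' hg'))

theorem hasSum_pow_div_factorial (c : ℂ) :
    HasSum (fun n : ℕ => c ^ n / (n.factorial : ℂ)) (Complex.exp c) := by
  rw [Complex.exp_eq_exp_ℂ]
  exact NormedSpace.expSeries_div_hasSum_exp c

theorem summable_norm_pow_div_factorial (c : ℂ) :
    Summable fun n : ℕ => ‖c ^ n / (n.factorial : ℂ)‖ := by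
  simpa using Real.summable_pow_div_factorial ‖c‖

theorem hasSum_exp_add (a b : ℂ) :
    HasSum (fun c : ℤ × ℕ => a ^ (c.2 + c.1.toNat) / ((c.2 + c.1.toNat).factorial : ℂ) *
      (b ^ (c.2 + (-c.1).toNat) / ((c.2 + (-c.1).toNat).factorial : ℂ)))
      (Complex.exp (a + b)) := by
  rw [Complex.exp_add]
  exact hasSum_mul_prod (f := fun k => a ^ k / (k.factorial : ℂ))
    (g := fun k => b ^ k / (k.factorial : ℂ)) (hasSum_pow_div_factorial a)
    (hasSum_pow_div_factorial b) (summable_norm_pow_div_factorial a)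
    (summable_norm_pow_div_factorial b)

/-- The Jacobi–Anger expansion, in complex coordinates. -/
theorem hasSum_circularWaveFun (κ : ℝ) {q : ℂ} (hq : q ≠ 0) (x : Plane) :
    HasSum (fun p : ℤ => (Complex.I * q) ^ p * circularWaveFun κ p x)
      (Complex.exp (Complex.I * κ / 2 *
        (toComplex x * q + (starRingEnd ℂ) (toComplex x) * q⁻¹))) := by
  set z := toComplex x with hz
  set a : ℂ := Complex.I * κ / 2 * (z * q) with ha
  set b : ℂ := Complex.I * κ / 2 * ((starRingEnd ℂ) z * q⁻¹) with hb
  have hI : Complex.I * q ≠ 0 := mul_ne_zero Complex.I_ne_zero hq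
  have hab : a * b = -(((κ ^ 2 * ‖x‖ ^ 2 / 4 : ℝ)) : ℂ) := by
    have : (((κ ^ 2 * ‖x‖ ^ 2 / 4 : ℝ)) : ℂ) = (κ : ℂ) ^ 2 / 4 * (z * (starRingEnd ℂ) z) := by
      rw [hz, ← ofReal_norm_sq]; push_cast; ring
    rw [this, ha, hb]
    field_simp
    linear_combination (4 * (κ : ℂ) ^ 2 * z * (starRingEnd ℂ) z) * Complex.I_sq
  have hbI : ((Complex.I * q) ^ (-1 : ℤ)) * (-1 * (κ / 2 * (starRingEnd ℂ) z)) = b := by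
    rw [hb, zpow_neg_one]
    field_simp
    linear_combination (-(κ : ℂ) * (starRingEnd ℂ) z) * Complex.I_sq
  have h := hasSum_exp_add a b
  rw [ha, hb, ← mul_add, ← ha, ← hb] at h
  -- In the fibre over `p`, the excess power of `a` or of `b` is the prefactor, and the powers of `a
  -- * b = -κ²‖x‖²/4` form the Bessel series.
  refine h.prod_fiberwise fun p => ?_
  obtain ⟨n, rfl | rfl⟩ := p.eq_nat_or_neg
  · have e : (Complex.I * q) ^ (n : ℤ) * circularWaveFun κ n x =
        a ^ n * besselSeries n (((κ ^ 2 * ‖x‖ ^ 2 / 4 : ℝ)) : ℂ) := by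
      rw [circularWaveFun_natCast, zpow_natCast]
      simp only [← hz]
      rw [← mul_assoc, ← mul_assoc, ← mul_pow, ← mul_pow]
      congr 2
      rw [ha]; ring
    rw [e]
    refine ((hasSum_besselSeries n _).mul_left (a ^ n)).congr_fun fun k => ?_
    rw [← hab]
    simp only [Int.toNat_natCast, Int.toNat_neg_natCast, add_zero, pow_add, mul_pow,
      add_comm n k]
    have h1 := factorial_cast_ne_zero k
    have h2 := factorial_cast_ne_zero (k + n)
    field_simp
  · have e : (Complex.I * q) ^ (-(n : ℤ)) * circularWaveFun κ (-(n : ℤ)) x =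
        b ^ n * besselSeries n (((κ ^ 2 * ‖x‖ ^ 2 / 4 : ℝ)) : ℂ) := by
      rw [circularWaveFun_neg_natCast]
      simp only [← hz]
      rw [← hbI, mul_pow, mul_pow, mul_pow, ← zpow_natCast
        ((Complex.I * q) ^ (-1 : ℤ)), ← zpow_mul, neg_one_mul]
      ring
    rw [e]
    refine ((hasSum_besselSeries n _).mul_left (b ^ n)).congr_fun fun k => ?_
    rw [← hab]
    simp only [Int.toNat_natCast, Int.toNat_neg_natCast, add_zero, pow_add, mul_pow, neg_neg,
      add_comm n k]
    have h1 := factorial_cast_ne_zero k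
    have h2 := factorial_cast_ne_zero (k + n)
    field_simp

/-- Euler's formulas for the complex angle `α` give `x₀ cos α + x₁ sin α = (z e^{-iα} + conj(z)
e^{iα}) / 2` with `z = x₀ + i x₁`. -/
theorem planeWaveFun_eq (κ : ℝ) (y : Cylinder) (x : Plane) :
    planeWaveFun κ y x = Complex.exp (Complex.I * κ / 2 *
      (toComplex x * Complex.exp (-(Complex.I * complexAngle y)) +
        (starRingEnd ℂ) (toComplex x) * (Complex.exp (-(Complex.I * complexAngle y)))⁻¹)) := by
  have hz : toComplex x = (x 0 : ℂ) + (x 1 : ℂ) * Complex.I := Complex.mk_eq_add_mul_I _ _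
  have hzc : (starRingEnd ℂ) (toComplex x) = (x 0 : ℂ) - (x 1 : ℂ) * Complex.I := by
    rw [hz]; simp [sub_eq_add_neg]
  rw [planeWaveFun, hzc, hz, ← Complex.exp_neg, neg_neg, Complex.cos, Complex.sin]
  congr 1
  rw [mul_comm (complexAngle y), neg_mul, mul_comm (complexAngle y)]
  ring

/-! ## Series in `L²` and in `H¹` -/

/-- The sum of a series in `Lᵖ` agrees almost everywhere with its pointwise sum. -/
theorem ae_eq_of_hasSum_Lp {α ι : Type*} [Countable ι] {m : MeasurableSpace α} {μ : Measure α}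
    {p : ℝ≥0∞} [Fact (1 ≤ p)] {F : ι → Lp ℂ p μ} {G : Lp ℂ p μ} {h : α → ℂ}
    (hF : HasSum F G) (hh : ∀ᵐ x ∂μ, HasSum (fun i => F i x) (h x)) : G =ᵐ[μ] h := by
  -- Norm convergence gives convergence in measure, hence almost everywhere along a sequence of
  -- finite sets; the pointwise sum has the same limit along that sequence.
  obtain ⟨ns, hns, hae⟩ := (tendstoInMeasure_of_tendsto_Lp
    (show Filter.Tendsto _ Filter.atTop _ from hF)).exists_seq_tendsto_ae'
  have hsum : ∀ᵐ x ∂μ, ∀ s : Finset ι, (∑ i ∈ s, F i : Lp ℂ p μ) x = ∑ i ∈ s, F i x := by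
    refine ae_all_iff.2 fun s => ?_
    filter_upwards [Lp.coeFn_fun_finsetSum s F] with x hx using hx
  filter_upwards [hae, hh, hsum] with x h1 h2 h3
  refine tendsto_nhds_unique h1 ?_
  have h4 : Filter.Tendsto (fun s : Finset ι => ∑ i ∈ s, F i x) Filter.atTop (nhds (h x)) := h2
  simpa only [h3, Function.comp_def] using h4.comp hns

/-- The class in `L²` of the disk of a continuous function on the plane. -/
def restrictL2 {f : Plane → ℂ} (hf : Continuous f) : L2Disk := (memLp_of_continuous hf).toLp f

theorem coeFn_restrictL2 {f : Plane → ℂ} (hf : Continuous f) :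
    restrictL2 hf =ᵐ[diskMeasure] f :=
  (memLp_of_continuous hf).coeFn_toLp

theorem ae_diskMeasure_mem : ∀ᵐ x ∂diskMeasure, x ∈ unitDisk :=
  ae_restrict_mem measurableSet_ball

/-- The Weierstrass M-test: on a finite measure space, uniform bounds control `L²` norms. The sum is
identified by its pointwise values. -/
theorem hasSum_restrictL2 {ι : Type*} [Countable ι] {f : ι → Plane → ℂ} {g : Plane → ℂ}
    (hf : ∀ i, Continuous (f i)) (hg : Continuous g) {u : ι → ℝ} (hu : Summable u)
    (hu0 : ∀ i, 0 ≤ u i)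
    (hfu : ∀ i, ∀ x ∈ unitDisk, ‖f i x‖ ≤ u i)
    (hs : ∀ x, HasSum (fun i => f i x) (g x)) :
    HasSum (fun i => restrictL2 (hf i)) (restrictL2 hg) := by
  have hsum : Summable fun i => restrictL2 (hf i) := by
    refine Summable.of_norm_bounded (g := fun i =>
      (measureUnivNNReal diskMeasure : ℝ) ^ (2 : ℝ≥0∞).toReal⁻¹ * u i) (hu.mul_left _) (fun i => ?_)
    refine Lp.norm_le_of_ae_bound (hu0 i) ?_
    filter_upwards [coeFn_restrictL2 (hf i), ae_diskMeasure_mem] with x hx hxd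
    rw [hx]
    exact hfu i x hxd
  have hae : ∀ᵐ x ∂diskMeasure, HasSum (fun i => restrictL2 (hf i) x) (g x) := by
    filter_upwards [ae_all_iff.2 fun i => coeFn_restrictL2 (hf i)] with x hx
    simpa only [hx] using hs x
  have := ae_eq_of_hasSum_Lp hsum.hasSum hae
  have h2 : ∑' i, restrictL2 (hf i) = restrictL2 hg :=
    Lp.ext (this.trans (coeFn_restrictL2 hg).symm)
  exact h2 ▸ hsum.hasSum

variable {κ : ℝ}

theorem H1.hasSum_of_components {ι : Type*} {U : ι → H1 κ} {V : H1 κ}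
    (h0 : HasSum (fun i => (U i).1.fst) V.1.fst)
    (h1 : ∀ j, HasSum (fun i => (U i).1.snd j) (V.1.snd j)) : HasSum U V := by
  have h2 : HasSum (fun i => ((U i).1 : JetSpace)) V.1 := by
    have ha : HasSum (fun i => (U i).1.snd) V.1.snd := by
      have := (Pi.hasSum (f := fun i => (fun j => (U i).1.snd j : Fin 2 → L2Disk))).2 h1
      exact this.mapL
        (PiLp.continuousLinearEquiv 2 ℂ (fun _ : Fin 2 => L2Disk)).symm.toContinuousLinearMap
    have := h0.prodMk ha
    exact this.mapL (WithLp.prodContinuousLinearEquiv 2 ℂ L2Disk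
      (PiLp 2 (fun _ : Fin 2 => L2Disk))).symm.toContinuousLinearMap
  exact (Topology.IsInducing.hasSum_iff (g := (weightedGraph κ).subtype)
    Topology.IsInducing.subtypeVal U V).1 h2

/-! ## Circular waves in `L²` and in `H¹` -/

/-- The circular wave as an element of `L²`. -/
def circularL2 (κ : ℝ) (p : ℤ) : L2Disk := restrictL2 (contDiff_circularWaveFun κ p).continuous

theorem circularWave_fst (hκ : 0 < κ) (p : ℤ) : (circularWave hκ p).1.fst = circularL2 κ p := rfl

theorem circularWave_snd (hκ : 0 < κ) (p : ℤ) (j : Fin 2) :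
    (circularWave hκ p).1.snd j = (2 : ℂ)⁻¹ • (unitDir j • circularL2 κ (p - 1) -
      (starRingEnd ℂ) (unitDir j) • circularL2 κ (p + 1)) := by
  have hκ' : (κ : ℂ) ≠ 0 := by exact_mod_cast hκ.ne'
  have hc := (contDiff_partialDeriv (m := 0) j (contDiff_circularWaveFun κ p) (by simp)).continuous
  change (κ : ℂ)⁻¹ • restrictL2 hc = _
  refine Lp.ext ?_
  filter_upwards [Lp.coeFn_smul (κ : ℂ)⁻¹ (restrictL2 hc), coeFn_restrictL2 hc,
    Lp.coeFn_smul (2 : ℂ)⁻¹ (unitDir j • circularL2 κ (p - 1) -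
      (starRingEnd ℂ) (unitDir j) • circularL2 κ (p + 1)),
    Lp.coeFn_sub (unitDir j • circularL2 κ (p - 1))
      ((starRingEnd ℂ) (unitDir j) • circularL2 κ (p + 1)),
    Lp.coeFn_smul (unitDir j) (circularL2 κ (p - 1)),
    Lp.coeFn_smul ((starRingEnd ℂ) (unitDir j)) (circularL2 κ (p + 1)),
    coeFn_restrictL2 (contDiff_circularWaveFun κ (p - 1)).continuous,
    coeFn_restrictL2 (contDiff_circularWaveFun κ (p + 1)).continuous] with x h1 h2 h3 h4 h5 h6 h7 h8
  rw [h1, Pi.smul_apply, h2, h3, Pi.smul_apply, h4, Pi.sub_apply, h5, h6, Pi.smul_apply,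
    Pi.smul_apply, circularL2, circularL2, h7, h8, partialDeriv_circularWaveFun]
  simp only [smul_eq_mul]
  field_simp

/-- The mixed terms, pairing `p - 1` with `q + 1` and `p + 1` with `q - 1`, cancel between the two
coordinates because `1² + i² = 0`. -/
theorem inner_circularWave (hκ : 0 < κ) (p q : ℤ) :
    inner ℂ (circularWave hκ p) (circularWave hκ q) =
      inner ℂ (circularL2 κ p) (circularL2 κ q) +
        2⁻¹ * (inner ℂ (circularL2 κ (p - 1)) (circularL2 κ (q - 1)) +
          inner ℂ (circularL2 κ (p + 1)) (circularL2 κ (q + 1))) := by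
  have h0 (U V : H1 κ) : inner ℂ U V = inner ℂ U.1.fst V.1.fst + inner ℂ U.1.snd V.1.snd := rfl
  rw [h0, PiLp.inner_apply, Fin.sum_univ_two]
  simp only [circularWave_fst, circularWave_snd, inner_smul_left, inner_smul_right,
    inner_sub_left, inner_sub_right]
  simp only [unitDir, Matrix.cons_val_zero, Matrix.cons_val_one, map_one, Complex.conj_I,
    map_neg, map_inv₀, Complex.conj_ofNat]
  ring_nf
  simp only [Complex.I_sq]
  ring

theorem norm_sq_circularWave (hκ : 0 < κ) (p : ℤ) :
    ‖circularWave hκ p‖ ^ 2 = ‖circularL2 κ p‖ ^ 2 +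
      2⁻¹ * (‖circularL2 κ (p - 1)‖ ^ 2 + ‖circularL2 κ (p + 1)‖ ^ 2) := by
  have h := inner_circularWave hκ p p
  simp only [inner_self_eq_norm_sq_to_K, RCLike.ofReal_eq_complex_ofReal] at h
  apply Complex.ofReal_injective
  push_cast
  exact h

/-! ### Orthogonality -/

/-- The rotation of the plane by the unit complex number `a`. -/
def planeRotation (a : Circle) : Plane ≃ₗᵢ[ℝ] Plane :=
  (Complex.orthonormalBasisOneI.repr.symm.trans (rotation a)).trans
    Complex.orthonormalBasisOneI.repr

theorem repr_symm_eq_toComplex (x : Plane) :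
    Complex.orthonormalBasisOneI.repr.symm x = toComplex x := by
  rw [LinearIsometryEquiv.symm_apply_eq]
  ext j
  fin_cases j <;> simp [toComplex]

theorem toComplex_planeRotation (a : Circle) (x : Plane) :
    toComplex (planeRotation a x) = a * toComplex x := by
  rw [← repr_symm_eq_toComplex, ← repr_symm_eq_toComplex]
  simp [planeRotation]

theorem circularWaveFun_planeRotation (κ : ℝ) (a : Circle) (p : ℤ) (x : Plane) :
    circularWaveFun κ p (planeRotation a x) = (a : ℂ) ^ p * circularWaveFun κ p x := by
  obtain ⟨n, rfl | rfl⟩ := p.eq_nat_or_neg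
  · simp only [circularWaveFun_natCast, toComplex_planeRotation, LinearIsometryEquiv.norm_map,
      zpow_natCast]
    ring
  · simp only [circularWaveFun_neg_natCast, toComplex_planeRotation, LinearIsometryEquiv.norm_map,
      zpow_neg, zpow_natCast, map_mul, ← Circle.coe_inv_eq_conj, Circle.coe_inv]
    ring

theorem integral_disk_comp_planeRotation (a : Circle) (F : Plane → ℂ) :
    ∫ x in unitDisk, F (planeRotation a x) = ∫ x in unitDisk, F x := by
  have h := (planeRotation a).measurePreserving.setIntegral_preimage_emb
    (planeRotation a).toHomeomorph.measurableEmbedding F unitDisk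
  rw [← h]
  congr 2
  ext x
  simp [unitDisk]

theorem inner_circularL2 (κ : ℝ) (p q : ℤ) :
    inner ℂ (circularL2 κ p) (circularL2 κ q) =
      ∫ x in unitDisk, circularWaveFun κ q x * (starRingEnd ℂ) (circularWaveFun κ p x) := by
  rw [L2.inner_def]
  refine integral_congr_ae ?_
  filter_upwards [coeFn_restrictL2 (contDiff_circularWaveFun κ p).continuous,
    coeFn_restrictL2 (contDiff_circularWaveFun κ q).continuous] with x h1 h2
  rw [circularL2, circularL2, h1, h2]
  rfl

/-- The rotation by the angle `π / (q - p)` preserves the disk and multiplies the integrand by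
`e^{iπ} = -1`, so the integral equals its own negative. -/
theorem inner_circularL2_of_ne (κ : ℝ) {p q : ℤ} (hpq : p ≠ q) :
    inner ℂ (circularL2 κ p) (circularL2 κ q) = 0 := by
  have hd : ((q : ℝ) - p) ≠ 0 := by
    rw [sub_ne_zero]; exact_mod_cast hpq.symm
  set a : Circle := Circle.exp (Real.pi / ((q : ℝ) - p)) with ha
  have ha1 : (a : ℂ) ^ q * (starRingEnd ℂ) ((a : ℂ) ^ p) = -1 := by
    rw [map_zpow₀, ← Circle.coe_inv_eq_conj, Circle.coe_inv, inv_zpow', ← zpow_add₀ (by simp), ha,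
      Circle.coe_exp, ← Complex.exp_int_mul, ← Complex.exp_pi_mul_I]
    congr 1
    have : ((q : ℂ) - p) ≠ 0 := by exact_mod_cast hd
    push_cast
    field_simp
    ring
  rw [inner_circularL2]
  set J := ∫ x in unitDisk, circularWaveFun κ q x * (starRingEnd ℂ) (circularWaveFun κ p x)
    with hJ
  have h := integral_disk_comp_planeRotation a
    (fun x => circularWaveFun κ q x * (starRingEnd ℂ) (circularWaveFun κ p x))
  have e : ∀ x, circularWaveFun κ q (planeRotation a x) *
      (starRingEnd ℂ) (circularWaveFun κ p (planeRotation a x)) =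
      -1 * (circularWaveFun κ q x * (starRingEnd ℂ) (circularWaveFun κ p x)) := by
    intro x
    rw [circularWaveFun_planeRotation, circularWaveFun_planeRotation, map_mul, ← ha1]
    ring
  simp only [e, integral_const_mul, ← hJ] at h
  linear_combination (-1 / 2 : ℂ) * h

theorem inner_circularWave_of_ne (hκ : 0 < κ) {p q : ℤ} (hpq : p ≠ q) :
    inner ℂ (circularWave hκ p) (circularWave hκ q) = 0 := by
  rw [inner_circularWave, inner_circularL2_of_ne κ hpq,
    inner_circularL2_of_ne κ (by omega : p - 1 ≠ q - 1),
    inner_circularL2_of_ne κ (by omega : p + 1 ≠ q + 1)]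
  simp

/-! ### The Jacobi–Anger expansion in `H¹` -/

theorem norm_circularWaveFun_le (κ : ℝ) (p : ℤ) {x : Plane} (hx : x ∈ unitDisk) :
    ‖circularWaveFun κ p x‖ ≤
      Real.exp (κ ^ 2 / 4) * ((|κ| / 2) ^ p.natAbs / (p.natAbs.factorial : ℝ)) := by
  have hx1 : ‖x‖ ≤ 1 := by simpa using (Metric.mem_ball.1 hx).le
  rw [norm_circularWaveFun_natAbs, norm_circularWaveFun_natCast]
  have h1 : ‖x‖ ^ p.natAbs ≤ 1 := pow_le_one₀ (norm_nonneg _) hx1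
  have h2 := norm_besselSeries_le p.natAbs (((κ ^ 2 * ‖x‖ ^ 2 / 4 : ℝ)) : ℂ)
  have h3 : ‖((κ ^ 2 * ‖x‖ ^ 2 / 4 : ℝ) : ℂ)‖ ≤ κ ^ 2 / 4 := by
    rw [Complex.norm_real, Real.norm_of_nonneg (by positivity)]
    have : ‖x‖ ^ 2 ≤ 1 := pow_le_one₀ (norm_nonneg _) hx1
    nlinarith [sq_nonneg κ]
  calc _ ≤ (|κ| / 2) ^ p.natAbs * 1 * (Real.exp (κ ^ 2 / 4) / (p.natAbs.factorial : ℝ)) := by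
        gcongr
        refine h2.trans ?_
        gcongr
    _ = _ := by ring

theorem summable_zpow_mul_pow_natAbs_div_factorial (a b : ℝ) :
    Summable fun p : ℤ => a ^ p * (b ^ p.natAbs / (p.natAbs.factorial : ℝ)) := by
  refine Summable.of_nat_of_neg ?_ ?_
  · refine (Real.summable_pow_div_factorial (a * b)).congr fun n => ?_
    simp only [zpow_natCast, Int.natAbs_natCast]
    rw [mul_pow]; ring
  · refine (Real.summable_pow_div_factorial (a⁻¹ * b)).congr fun n => ?_
    simp only [zpow_neg, zpow_natCast, Int.natAbs_natCast, Int.natAbs_neg]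
    rw [mul_pow, inv_pow]; ring

theorem hasSum_circularL2 (κ : ℝ) (y : Cylinder) :
    HasSum (fun p : ℤ => (Complex.I * Complex.exp (-(Complex.I * complexAngle y))) ^ p •
      circularL2 κ p) (restrictL2 (contDiff_planeWaveFun κ y).continuous) := by
  set q := Complex.exp (-(Complex.I * complexAngle y)) with hq
  have hq0 : q ≠ 0 := Complex.exp_ne_zero _
  have h := hasSum_restrictL2
    (f := fun p x => (Complex.I * q) ^ p * circularWaveFun κ p x)
    (fun p => continuous_const.mul (contDiff_circularWaveFun κ p).continuous)
    (contDiff_planeWaveFun κ y).continuous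
    ((summable_zpow_mul_pow_natAbs_div_factorial ‖q‖ (|κ| / 2)).mul_left
      (Real.exp (κ ^ 2 / 4)))
    (fun p => by positivity)
    (fun p x hx => by
      rw [norm_mul, norm_zpow, norm_mul, Complex.norm_I, one_mul]
      have := mul_le_mul_of_nonneg_left (norm_circularWaveFun_le κ p hx)
        (by positivity : 0 ≤ ‖q‖ ^ p)
      refine this.trans (le_of_eq (by ring)))
    (fun x => by
      rw [planeWaveFun_eq]
      exact hasSum_circularWaveFun κ hq0 x)
  exact h

theorem partialDeriv_planeWaveFun (κ : ℝ) (y : Cylinder) (j : Fin 2) (x : Plane) :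
    partialDeriv j (planeWaveFun κ y) x =
      Complex.I * κ * ![Complex.cos (complexAngle y), Complex.sin (complexAngle y)] j *
        planeWaveFun κ y x := by
  refine partialDeriv_eq_of_hasDerivAt (contDiff_planeWaveFun κ y) ?_
  set c := ![Complex.cos (complexAngle y), Complex.sin (complexAngle y)] j with hc
  have e : (fun s : ℝ => planeWaveFun κ y (x + s • EuclideanSpace.single j 1)) =
      fun s : ℝ => Complex.exp (Complex.I * κ * (Complex.cos (complexAngle y) * (x 0 : ℂ) +
        Complex.sin (complexAngle y) * (x 1 : ℂ) + s * c)) := by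
    funext s
    rw [planeWaveFun, hc]
    congr 2
    fin_cases j <;> simp <;> ring
  rw [e]
  have h := ((((hasDerivAt_id (0 : ℂ)).mul_const c).const_add (Complex.cos (complexAngle y) *
    (x 0 : ℂ) + Complex.sin (complexAngle y) * (x 1 : ℂ))).const_mul (Complex.I * κ)).cexp
  refine (HasDerivAt.comp_ofReal (z := (0 : ℝ)) (by simpa using h)).congr_deriv ?_
  rw [planeWaveFun]
  ring

theorem planeWave_snd (hκ : 0 < κ) (y : Cylinder) (j : Fin 2) :
    (planeWave hκ y).1.snd j =
      (Complex.I * ![Complex.cos (complexAngle y), Complex.sin (complexAngle y)] j) •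
        restrictL2 (contDiff_planeWaveFun κ y).continuous := by
  have hκ' : (κ : ℂ) ≠ 0 := by exact_mod_cast hκ.ne'
  have hc := (contDiff_partialDeriv (m := 0) j (contDiff_planeWaveFun κ y) (by simp)).continuous
  have hp := (contDiff_planeWaveFun κ y).continuous
  change (κ : ℂ)⁻¹ • restrictL2 hc = _
  refine Lp.ext ?_
  filter_upwards [Lp.coeFn_smul (κ : ℂ)⁻¹ (restrictL2 hc), coeFn_restrictL2 hc,
    Lp.coeFn_smul (Complex.I * ![Complex.cos (complexAngle y), Complex.sin (complexAngle y)] j)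
      (restrictL2 hp), coeFn_restrictL2 hp] with x h1 h2 h3 h4
  rw [h1, h3, Pi.smul_apply, Pi.smul_apply, h2, h4, partialDeriv_planeWaveFun]
  simp only [smul_eq_mul]
  field_simp

/-- The gradient components need no new estimate: they are combinations of the `L²` expansion
shifted by one index in each direction, which multiplies its sum by `(iq)^{±1}`. -/
theorem hasSum_circularWave (hκ : 0 < κ) (y : Cylinder) :
    HasSum (fun p : ℤ => (Complex.I * Complex.exp (-(Complex.I * complexAngle y))) ^ p •
      circularWave hκ p) (planeWave hκ y) := by
  have h := hasSum_circularL2 κ y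
  set q := Complex.exp (-(Complex.I * complexAngle y)) with hq
  have hq1 : q ≠ 0 := Complex.exp_ne_zero _
  have hq0 : Complex.I * q ≠ 0 := mul_ne_zero Complex.I_ne_zero hq1
  refine H1.hasSum_of_components h fun j => ?_
  have h1 := ((Equiv.subRight (1 : ℤ)).hasSum_iff.2 h).const_smul (Complex.I * q)
  have h2 := ((Equiv.addRight (1 : ℤ)).hasSum_iff.2 h).const_smul (Complex.I * q)⁻¹
  have h3 := ((h1.const_smul (unitDir j)).sub
    (h2.const_smul ((starRingEnd ℂ) (unitDir j)))).const_smul (2 : ℂ)⁻¹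
  rw [planeWave_snd]
  -- The two shifted sums recombine, by Euler's formulas, into `i cos` and `i sin` of the complex
  -- angle, as in the gradient of the plane wave.
  have e : (2 : ℂ)⁻¹ • (unitDir j • (Complex.I * q) •
        restrictL2 (contDiff_planeWaveFun κ y).continuous -
      (starRingEnd ℂ) (unitDir j) • (Complex.I * q)⁻¹ •
        restrictL2 (contDiff_planeWaveFun κ y).continuous) =
      (Complex.I * ![Complex.cos (complexAngle y), Complex.sin (complexAngle y)] j) •
        restrictL2 (contDiff_planeWaveFun κ y).continuous := by
    rw [smul_smul, smul_smul, ← sub_smul, smul_smul]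
    congr 1
    have hqi : q⁻¹ = Complex.exp (complexAngle y * Complex.I) := by
      rw [hq, ← Complex.exp_neg, neg_neg, mul_comm]
    have hq' : q = Complex.exp (-complexAngle y * Complex.I) := by
      rw [hq, mul_comm, neg_mul]
    rw [mul_inv, Complex.inv_I, hqi, hq', Complex.cos, Complex.sin]
    fin_cases j
    · simp [unitDir]; ring
    · simp [unitDir]; ring_nf
  rw [← e]
  refine h3.congr_fun fun p => ?_
  change (Complex.I * q) ^ p • (circularWave hκ p).1.snd j = _
  rw [circularWave_snd]
  simp only [Function.comp_apply, Equiv.subRight_apply, Equiv.coe_addRight, zpow_sub_one₀ hq0,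
    zpow_add_one₀ hq0, smul_sub, smul_smul]
  congr 2 <;> field_simp

/-! ## Norms of circular waves -/

theorem norm_sq_circularL2 (κ : ℝ) (p : ℤ) :
    ‖circularL2 κ p‖ ^ 2 = ∫ x in unitDisk, ‖circularWaveFun κ p x‖ ^ 2 := by
  have h := inner_circularL2 κ p p
  simp only [inner_self_eq_norm_sq_to_K, RCLike.ofReal_eq_complex_ofReal, Complex.mul_conj,
    Complex.normSq_eq_norm_sq] at h
  rw [integral_complex_ofReal] at h
  exact_mod_cast h

theorem norm_circularL2_neg (κ : ℝ) (p : ℤ) : ‖circularL2 κ (-p)‖ = ‖circularL2 κ p‖ := by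
  have h : ‖circularL2 κ (-p)‖ ^ 2 = ‖circularL2 κ p‖ ^ 2 := by
    simp only [norm_sq_circularL2, norm_circularWaveFun_neg]
  exact (sq_eq_sq₀ (norm_nonneg _) (norm_nonneg _)).1 h

theorem norm_circularWave_neg (hκ : 0 < κ) (p : ℤ) :
    ‖circularWave hκ (-p)‖ = ‖circularWave hκ p‖ := by
  have h : ‖circularWave hκ (-p)‖ ^ 2 = ‖circularWave hκ p‖ ^ 2 := by
    rw [norm_sq_circularWave, norm_sq_circularWave, show -p - 1 = -(p + 1) by ring,
      show -p + 1 = -(p - 1) by ring]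
    simp only [norm_circularL2_neg]
    ring
  exact (sq_eq_sq₀ (norm_nonneg _) (norm_nonneg _)).1 h

theorem norm_circularWave_natAbs (hκ : 0 < κ) (p : ℤ) :
    ‖circularWave hκ p‖ = ‖circularWave hκ (p.natAbs : ℤ)‖ := by
  rcases Int.natAbs_eq p with h | h
  · rw [← h]
  · conv_lhs => rw [h]
    exact norm_circularWave_neg _ _

/-- The area of the unit disk. -/
def diskArea : ℝ := volume.real (Metric.ball (0 : Plane) 1)

theorem diskArea_pos : 0 < diskArea :=
  ENNReal.toReal_pos (Metric.measure_ball_pos _ _ one_pos).ne' measure_ball_lt_top.ne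

theorem integral_disk_norm_pow (n : ℕ) :
    ∫ x in unitDisk, ‖x‖ ^ (2 * n) = diskArea / (n + 1) := by
  have h := integral_fun_norm_addHaar (volume : Measure Plane)
    ((Set.Iio (1 : ℝ)).indicator fun r => r ^ (2 * n))
  have h1 : ∀ x : Plane, (Set.Iio (1 : ℝ)).indicator (fun r => r ^ (2 * n)) ‖x‖ =
      unitDisk.indicator (fun x => ‖x‖ ^ (2 * n)) x := by
    intro x
    by_cases hx : ‖x‖ < 1
    · rw [Set.indicator_of_mem (by simpa using hx), Set.indicator_of_mem (by simpa [unitDisk])]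
    · rw [Set.indicator_of_notMem (by simpa using hx),
        Set.indicator_of_notMem (by simpa [unitDisk] using hx)]
  simp only [h1] at h
  rw [integral_indicator (show MeasurableSet unitDisk from measurableSet_ball)] at h
  rw [h]
  have h2 : ∀ y : ℝ, y ^ (Module.finrank ℝ Plane - 1) •
      (Set.Iio (1 : ℝ)).indicator (fun r => r ^ (2 * n)) y =
      (Set.Iio (1 : ℝ)).indicator (fun r => r ^ (2 * n + 1)) y := by
    intro y
    by_cases hy : y ∈ Set.Iio (1 : ℝ)
    · simp only [Set.indicator_of_mem hy, finrank_euclideanSpace_fin, smul_eq_mul]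
      ring
    · simp only [Set.indicator_of_notMem hy, smul_zero]
  simp only [h2]
  rw [setIntegral_indicator measurableSet_Iio, Set.Ioi_inter_Iio, ← integral_Ioc_eq_integral_Ioo,
    ← intervalIntegral.integral_of_le zero_le_one, integral_pow, finrank_euclideanSpace_fin]
  have : (n : ℝ) + 1 ≠ 0 := by positivity
  simp only [smul_eq_mul, nsmul_eq_mul, diskArea]
  push_cast
  field_simp
  simp
  ring

theorem integrableOn_disk {f : Plane → ℝ} (hf : Continuous f) : IntegrableOn f unitDisk :=
  (hf.continuousOn.integrableOn_compact (isCompact_closedBall (0 : Plane) 1)).mono_set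
    Metric.ball_subset_closedBall

/-- The leading order of `‖b̃_n‖²` in `L²`. -/
def leadingNorm (κ : ℝ) (n : ℕ) : ℝ :=
  (κ / 2) ^ (2 * n) / (n.factorial : ℝ) ^ 2 * (diskArea / (n + 1))

theorem norm_sq_circularL2_le (hκ : 0 < κ) (n : ℕ) :
    ‖circularL2 κ n‖ ^ 2 ≤ Real.exp (κ ^ 2 / 4) ^ 2 * leadingNorm κ n := by
  rw [norm_sq_circularL2, leadingNorm, ← integral_disk_norm_pow, ← integral_const_mul,
    ← integral_const_mul]
  refine setIntegral_mono_on
    (integrableOn_disk ((contDiff_circularWaveFun κ n).continuous.norm.pow 2))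
    (integrableOn_disk (by fun_prop)) measurableSet_ball fun x hx => ?_
  have hx1 : ‖x‖ ≤ 1 := by simpa using (Metric.mem_ball.1 hx).le
  have h2 := norm_besselSeries_le n (((κ ^ 2 * ‖x‖ ^ 2 / 4 : ℝ)) : ℂ)
  have h3 : ‖((κ ^ 2 * ‖x‖ ^ 2 / 4 : ℝ) : ℂ)‖ ≤ κ ^ 2 / 4 := by
    rw [Complex.norm_real, Real.norm_of_nonneg (by positivity)]
    have : ‖x‖ ^ 2 ≤ 1 := pow_le_one₀ (norm_nonneg _) hx1
    nlinarith [sq_nonneg κ]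
  rw [norm_circularWaveFun_natCast, abs_of_pos hκ]
  calc _ ≤ ((κ / 2) ^ n * ‖x‖ ^ n * (Real.exp (κ ^ 2 / 4) / n.factorial)) ^ 2 := by
        gcongr
        exact h2.trans (by gcongr)
    _ = _ := by ring

/-- Under this hypothesis the terms after the first contribute at most half of the first one. -/
theorem half_div_factorial_le_norm_besselSeries {n : ℕ} {t : ℂ}
    (h : Real.exp (‖t‖ / (n + 1)) ≤ 3 / 2) :
    1 / 2 / (n.factorial : ℝ) ≤ ‖besselSeries n t‖ := by
  have h5 : (0 : ℝ) < (n.factorial : ℝ) := by exact_mod_cast Nat.factorial_pos _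
  rw [div_le_iff₀ h5]
  have h1 := norm_factorial_mul_besselSeries_sub_one_le n t
  have h2 := norm_sub_norm_le 1 ((n.factorial : ℂ) * besselSeries n t)
  rw [norm_sub_rev, norm_one, norm_mul, Complex.norm_natCast] at h2
  linarith [mul_comm ‖besselSeries n t‖ (n.factorial : ℝ)]

theorem le_norm_sq_circularL2 (hκ : 0 < κ) {n : ℕ}
    (hn : Real.exp (κ ^ 2 / 4 / (n + 1)) ≤ 3 / 2) :
    1 / 4 * leadingNorm κ n ≤ ‖circularL2 κ n‖ ^ 2 := by
  rw [norm_sq_circularL2, leadingNorm, ← integral_disk_norm_pow, ← integral_const_mul,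
    ← integral_const_mul]
  refine setIntegral_mono_on (integrableOn_disk (by fun_prop))
    (integrableOn_disk ((contDiff_circularWaveFun κ n).continuous.norm.pow 2))
    measurableSet_ball fun x hx => ?_
  have hx1 : ‖x‖ ≤ 1 := by simpa using (Metric.mem_ball.1 hx).le
  have h3 : ‖((κ ^ 2 * ‖x‖ ^ 2 / 4 : ℝ) : ℂ)‖ ≤ κ ^ 2 / 4 := by
    rw [Complex.norm_real, Real.norm_of_nonneg (by positivity)]
    have : ‖x‖ ^ 2 ≤ 1 := pow_le_one₀ (norm_nonneg _) hx1
    nlinarith [sq_nonneg κ]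
  have h4 : 1 / 2 / (n.factorial : ℝ) ≤
      ‖besselSeries n (((κ ^ 2 * ‖x‖ ^ 2 / 4 : ℝ)) : ℂ)‖ := by
    refine half_div_factorial_le_norm_besselSeries (le_trans ?_ hn)
    gcongr
  rw [norm_circularWaveFun_natCast, abs_of_pos hκ]
  calc _ = ((κ / 2) ^ n * ‖x‖ ^ n * (1 / 2 / n.factorial)) ^ 2 := by ring
    _ ≤ _ := by gcongr

/-- A continuous function that vanishes almost everywhere on the open disk vanishes everywhere
there. At a point of radius `r > 0` with `κ r ≤ 1` the first term of the Bessel series dominates for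
every order, so the wave is not zero. -/
theorem circularL2_ne_zero (hκ : 0 < κ) (p : ℤ) : circularL2 κ p ≠ 0 := by
  intro h0
  have hae : circularWaveFun κ p =ᵐ[diskMeasure] fun _ => 0 := by
    refine (coeFn_restrictL2 (contDiff_circularWaveFun κ p).continuous).symm.trans ?_
    change circularL2 κ p =ᵐ[diskMeasure] _
    rw [h0]
    exact Lp.coeFn_zero _ _ _
  have h1 := Measure.eqOn_open_of_ae_eq hae Metric.isOpen_ball
    (contDiff_circularWaveFun κ p).continuous.continuousOn continuousOn_const
  set r : ℝ := min (1 / 2) (1 / κ) with hr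
  have hr0 : 0 < r := lt_min (by norm_num) (by positivity)
  have hr1 : r < 1 := (min_le_left _ _).trans_lt (by norm_num)
  have hr2 : κ * r ≤ 1 := by
    have : r ≤ 1 / κ := min_le_right _ _
    rwa [le_div_iff₀ hκ, mul_comm] at this
  set x : Plane := EuclideanSpace.single 0 r with hx
  have hxn : ‖x‖ = r := by
    simp [hx, abs_of_pos hr0]
  have h2 : ‖circularWaveFun κ p x‖ = 0 := by
    rw [norm_eq_zero]
    exact h1 (by simpa [unitDisk, hxn] using hr1)
  rw [norm_circularWaveFun_natAbs, norm_circularWaveFun_natCast, abs_of_pos hκ, hxn] at h2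
  set n := p.natAbs
  have h5 : (0 : ℝ) < (n.factorial : ℝ) := by exact_mod_cast Nat.factorial_pos _
  have h3 : 1 / 2 / (n.factorial : ℝ) ≤ ‖besselSeries n (((κ ^ 2 * r ^ 2 / 4 : ℝ)) : ℂ)‖ := by
    refine half_div_factorial_le_norm_besselSeries ?_
    rw [Complex.norm_real, Real.norm_of_nonneg (by positivity)]
    have h6 : κ ^ 2 * r ^ 2 / 4 / ((n : ℝ) + 1) ≤ 1 / 4 := by
      refine (div_le_self (by positivity) (by linarith [n.cast_nonneg (α := ℝ)])).trans ?_
      rw [← mul_pow]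
      have : (κ * r) ^ 2 ≤ 1 := pow_le_one₀ (by positivity) hr2
      linarith
    -- From `e^x ≤ 1 / (1 - x)` at `x = 1/4`, which gives `4/3`.
    have h7 : Real.exp (1 / 4) ≤ 3 / 2 := by
      have := Real.exp_bound_div_one_sub_of_interval (x := 1 / 4) (by norm_num) (by norm_num)
      refine this.trans (by norm_num)
    exact (Real.exp_le_exp.2 h6).trans h7
  have : 0 < (κ / 2) ^ n * r ^ n * ‖besselSeries n (((κ ^ 2 * r ^ 2 / 4 : ℝ)) : ℂ)‖ := by
    have : 0 < ‖besselSeries n (((κ ^ 2 * r ^ 2 / 4 : ℝ)) : ℂ)‖ :=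
      lt_of_lt_of_le (by positivity) h3
    positivity
  exact this.ne' h2

theorem norm_circularWave_pos (hκ : 0 < κ) (p : ℤ) : 0 < ‖circularWave hκ p‖ := by
  have h1 : 0 < ‖circularL2 κ p‖ := norm_pos_iff.2 (circularL2_ne_zero hκ p)
  have h2 : 0 < ‖circularWave hκ p‖ ^ 2 := by
    rw [norm_sq_circularWave]
    positivity
  exact (norm_nonneg _).lt_of_ne fun h => by simp [← h] at h2

/-- The order of growth of `‖b̃_n‖²` in `H¹`. -/
def circularRate (κ : ℝ) (n : ℕ) : ℝ := (κ / 2) ^ (2 * n) * n / (n.factorial : ℝ) ^ 2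

/-- The rate is indexed by the `H¹` wave: for order `n + 1`, the leading part of the squared norm
comes from the neighbour of order `n` in the gradient. -/
theorem leadingNorm_eq_rate (hκ : 0 < κ) (n : ℕ) :
    leadingNorm κ n = diskArea * (2 / κ) ^ 2 * circularRate κ (n + 1) := by
  have h5 : (n.factorial : ℝ) ≠ 0 := by exact_mod_cast n.factorial_ne_zero
  rw [leadingNorm, circularRate, Nat.factorial_succ]
  push_cast
  field_simp
  ring

theorem leadingNorm_le_rate (hκ : 0 < κ) {n : ℕ} (hn : 1 ≤ n) :
    leadingNorm κ n ≤ diskArea * circularRate κ n := by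
  have h1 : (1 : ℝ) ≤ n := by exact_mod_cast hn
  have h2 : (0 : ℝ) < (n.factorial : ℝ) := by exact_mod_cast Nat.factorial_pos _
  rw [leadingNorm, circularRate]
  have h3 : diskArea / ((n : ℝ) + 1) ≤ diskArea * n := by
    have := diskArea_pos
    rw [div_le_iff₀ (by positivity)]
    nlinarith [mul_nonneg this.le (by linarith : (0 : ℝ) ≤ n - 1)]
  calc _ ≤ (κ / 2) ^ (2 * n) / (n.factorial : ℝ) ^ 2 * (diskArea * n) := by gcongr
    _ = _ := by ring

theorem circularRate_pos (hκ : 0 < κ) {n : ℕ} (hn : 1 ≤ n) : 0 < circularRate κ n := by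
  have h2 : (0 : ℝ) < (n.factorial : ℝ) := by exact_mod_cast Nat.factorial_pos _
  have h1 : (0 : ℝ) < n := by exact_mod_cast hn
  rw [circularRate]
  positivity

theorem circularRate_succ_le (hκ : 0 < κ) {n : ℕ} (hn : 1 ≤ n) :
    circularRate κ (n + 1) ≤ (κ / 2) ^ 2 * circularRate κ n := by
  have h1 : (1 : ℝ) ≤ n := by exact_mod_cast hn
  have h2 : (0 : ℝ) < (n.factorial : ℝ) := by exact_mod_cast Nat.factorial_pos _
  rw [circularRate, circularRate, Nat.factorial_succ]
  push_cast
  have e : (κ / 2) ^ (2 * (n + 1)) * ((n : ℝ) + 1) / (((n : ℝ) + 1) * (n.factorial : ℝ)) ^ 2 =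
      (κ / 2) ^ 2 * ((κ / 2) ^ (2 * n) * (1 / ((n : ℝ) + 1)) / (n.factorial : ℝ) ^ 2) := by
    field_simp
    ring
  rw [e]
  gcongr
  rw [div_le_iff₀ (by positivity)]
  nlinarith

theorem exists_bounds_norm_sq_circularWave (hκ : 0 < κ) :
    ∃ c C : ℝ, 0 < c ∧ 0 < C ∧ ∃ n₀ : ℕ, ∀ n : ℕ, n₀ ≤ n →
      c * circularRate κ n ≤ ‖circularWave hκ n‖ ^ 2 ∧
        ‖circularWave hκ n‖ ^ 2 ≤ C * circularRate κ n := by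
  have hA := diskArea_pos
  obtain ⟨n₀, hn₀⟩ : ∃ n₀ : ℕ, ∀ n : ℕ, n₀ ≤ n → Real.exp (κ ^ 2 / 4 / ((n : ℝ) + 1)) ≤ 3 / 2 := by
    have h1 : Filter.Tendsto (fun n : ℕ => Real.exp (κ ^ 2 / 4 / ((n : ℝ) + 1))) Filter.atTop
        (nhds (Real.exp 0)) := by
      refine (Real.continuous_exp.tendsto 0).comp ?_
      exact tendsto_const_nhds.div_atTop
        (Filter.tendsto_atTop_add_const_right _ _ tendsto_natCast_atTop_atTop)
    rw [Real.exp_zero] at h1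
    exact Filter.eventually_atTop.1 (h1.eventually_le_const (by norm_num))
  set E : ℝ := Real.exp (κ ^ 2 / 4) ^ 2 with hE
  have hE0 : 0 < E := by positivity
  -- The lower constant keeps only the order `n - 1`, with `1/8 = 1/2 · 1/4`; the upper one adds the
  -- orders `n`, `n - 1` and `n + 1`. The threshold is `n₀ + 1` because the lower bound is applied
  -- at `n - 1`.
  refine ⟨1 / 8 * (diskArea * (2 / κ) ^ 2),
    E * diskArea * (1 + 2⁻¹ * ((2 / κ) ^ 2 + (κ / 2) ^ 2)), by positivity, by positivity,
    n₀ + 1, fun n hn => ?_⟩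
  obtain ⟨m, rfl⟩ : ∃ m, n = m + 1 := ⟨n - 1, by omega⟩
  have e1 : ((m + 1 : ℕ) : ℤ) - 1 = (m : ℤ) := by push_cast; ring
  have e2 : ((m + 1 : ℕ) : ℤ) + 1 = ((m + 2 : ℕ) : ℤ) := by push_cast; ring
  rw [norm_sq_circularWave, e1, e2]
  constructor
  · have h1 := le_norm_sq_circularL2 hκ (hn₀ m (by omega))
    rw [leadingNorm_eq_rate hκ] at h1
    have h2 := sq_nonneg ‖circularL2 κ ((m + 1 : ℕ) : ℤ)‖
    have h3 := sq_nonneg ‖circularL2 κ ((m + 2 : ℕ) : ℤ)‖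
    linarith
  · have h1 := norm_sq_circularL2_le hκ m
    rw [leadingNorm_eq_rate hκ, ← hE] at h1
    have h2 := (norm_sq_circularL2_le hκ (m + 1)).trans
      (mul_le_mul_of_nonneg_left (leadingNorm_le_rate hκ (by omega)) hE0.le)
    have h3 := (norm_sq_circularL2_le hκ (m + 2)).trans
      (mul_le_mul_of_nonneg_left ((leadingNorm_le_rate hκ (by omega)).trans
        (mul_le_mul_of_nonneg_left (circularRate_succ_le hκ (by omega)) hA.le)) hE0.le)
    linarith

/-! ## The growth of `Γ(2n + 1/2) n / (4ⁿ n!²)` -/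

/-- The quotient `Γ(2n + 1/2) n / (4ⁿ n!²)`. -/
def gammaRatio (n : ℕ) : ℝ :=
  Real.Gamma (2 * n + 1 / 2) * n / (4 ^ n * (n.factorial : ℝ) ^ 2)

theorem gammaRatio_pos {n : ℕ} (hn : 1 ≤ n) : 0 < gammaRatio n := by
  have h1 : (0 : ℝ) < n := by exact_mod_cast hn
  have h2 : (0 : ℝ) < (n.factorial : ℝ) := by exact_mod_cast Nat.factorial_pos _
  have h3 : 0 < Real.Gamma (2 * n + 1 / 2) := Real.Gamma_pos_of_pos (by positivity)
  rw [gammaRatio]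
  positivity

theorem gammaRatio_succ {n : ℕ} (hn : 1 ≤ n) :
    gammaRatio (n + 1) = gammaRatio n * (1 + 3 / (16 * n * (n + 1))) := by
  have h1 : (0 : ℝ) < n := by exact_mod_cast hn
  have h2 : (0 : ℝ) < (n.factorial : ℝ) := by exact_mod_cast Nat.factorial_pos _
  have e : Real.Gamma (2 * ((n + 1 : ℕ) : ℝ) + 1 / 2) =
      (2 * n + 1 / 2 + 1) * ((2 * n + 1 / 2) * Real.Gamma (2 * n + 1 / 2)) := by
    rw [← Real.Gamma_add_one (by positivity), ← Real.Gamma_add_one (by positivity)]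
    congr 1
    push_cast
    ring
  rw [gammaRatio, gammaRatio, e, Nat.factorial_succ]
  push_cast
  field_simp
  ring

/-- The quotient increases, while its product with `1 + 1/n` decreases; at `n = 1` that product is
twice the quotient. -/
theorem gammaRatio_bounds {n : ℕ} (hn : 1 ≤ n) :
    gammaRatio 1 ≤ gammaRatio n ∧ gammaRatio n * (1 + 1 / n) ≤ 2 * gammaRatio 1 := by
  induction n, hn using Nat.le_induction with
  | base => exact ⟨le_rfl, by push_cast; linarith⟩
  | succ n hn ih =>
    have h1 : (1 : ℝ) ≤ n := by exact_mod_cast hn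
    have h2 := gammaRatio_pos hn
    rw [gammaRatio_succ hn]
    refine ⟨ih.1.trans (le_mul_of_one_le_right h2.le ?_), le_trans ?_ ih.2⟩
    · have : (0 : ℝ) ≤ 3 / (16 * n * (n + 1)) := by positivity
      linarith
    · rw [mul_assoc]
      refine mul_le_mul_of_nonneg_left ?_ h2.le
      push_cast
      have h3 : (0 : ℝ) < n := by linarith
      rw [← sub_nonneg]
      have : 1 + 1 / (n : ℝ) - (1 + 3 / (16 * n * (n + 1))) * (1 + 1 / ((n : ℝ) + 1)) =
          (13 * n + 10 : ℝ) / (16 * n * (n + 1) ^ 2) := by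
        field_simp
        ring
      rw [this]
      positivity

theorem gammaRatio_le {n : ℕ} (hn : 1 ≤ n) : gammaRatio n ≤ 2 * gammaRatio 1 := by
  refine le_trans (le_mul_of_one_le_right (gammaRatio_pos hn).le ?_) (gammaRatio_bounds hn).2
  have : (0 : ℝ) ≤ 1 / n := by positivity
  linarith

/-! ## Integrals of doubly exponential functions -/

theorem integrable_exp_sub_exp {κ s : ℝ} (hκ : 0 < κ) (hs : 0 < s) :
    Integrable (fun x => Real.exp (s * x - κ * Real.exp x)) ∧
      ∫ x, Real.exp (s * x - κ * Real.exp x) = (1 / κ) ^ s * Real.Gamma s := by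
  have hi : ∫ x, Real.exp (s * x - κ * Real.exp x) = (1 / κ) ^ s * Real.Gamma s := by
    -- The substitution `t = e^x` turns Euler's integral for `Γ` into the integral over the whole
    -- line.
    have h := integral_image_eq_integral_abs_deriv_smul (s := Set.univ) (f := Real.exp)
      (f' := Real.exp) MeasurableSet.univ (fun x _ => (Real.hasDerivAt_exp x).hasDerivWithinAt)
      Real.exp_injective.injOn (fun t => t ^ (s - 1) * Real.exp (-(κ * t)))
    rw [Set.image_univ, Real.range_exp, Real.integral_rpow_mul_exp_neg_mul_Ioi hs hκ,
      setIntegral_univ] at h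
    rw [h]
    refine integral_congr_ae (Filter.Eventually.of_forall fun x => ?_)
    simp only [abs_of_pos (Real.exp_pos x), smul_eq_mul, ← Real.exp_mul, ← Real.exp_add]
    congr 1
    ring
  refine ⟨?_, hi⟩
  -- The integral of a non-integrable function is zero by convention, so the positive value just
  -- found forces integrability.
  by_contra hn
  rw [integral_undef hn] at hi
  have : 0 < (1 / κ) ^ s * Real.Gamma s :=
    mul_pos (Real.rpow_pos_of_pos (by positivity) _) (Real.Gamma_pos_of_pos hs)
  exact this.ne hi

/-- The left half-line contributes at most `1/s ≤ 2`, and the interval `(0, 1]` alone contributes at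
least `e^{-κe}`. The right half-line therefore carries a fixed share of the integral, uniformly in
`s`. -/
theorem integral_exp_sub_exp_le {κ s : ℝ} (hκ : 0 < κ) (hs : 1 / 2 ≤ s) :
    ∫ x, Real.exp (s * x - κ * Real.exp x) ≤ (1 + 2 * Real.exp (κ * Real.exp 1)) *
      ∫ x in Set.Ioi (0 : ℝ), Real.exp (s * x - κ * Real.exp x) := by
  have hs0 : 0 < s := by linarith
  have hint := (integrable_exp_sub_exp hκ hs0).1
  have h1 : ∫ x in Set.Iic (0 : ℝ), Real.exp (s * x - κ * Real.exp x) ≤ 2 := by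
    have h2 : ∫ x in Set.Iic (0 : ℝ), Real.exp (s * x) ≤ 2 := by
      rw [integral_exp_mul_Iic hs0, mul_zero, Real.exp_zero, div_le_iff₀ hs0]
      linarith
    refine le_trans ?_ h2
    refine integral_mono hint.integrableOn (integrableOn_exp_mul_Iic hs0 0) fun x => ?_
    refine Real.exp_le_exp.2 ?_
    have : 0 < κ * Real.exp x := by positivity
    linarith
  have h3 : Real.exp (-(κ * Real.exp 1)) ≤
      ∫ x in Set.Ioi (0 : ℝ), Real.exp (s * x - κ * Real.exp x) := by
    have h4 : ∫ x in Set.Ioc (0 : ℝ) 1, Real.exp (s * x - κ * Real.exp x) ≤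
        ∫ x in Set.Ioi (0 : ℝ), Real.exp (s * x - κ * Real.exp x) :=
      setIntegral_mono_set hint.integrableOn
        (Filter.Eventually.of_forall fun x => (Real.exp_pos _).le)
        (Filter.Eventually.of_forall Set.Ioc_subset_Ioi_self)
    refine le_trans ?_ h4
    have h5 : ∫ x in Set.Ioc (0 : ℝ) 1, Real.exp (-(κ * Real.exp 1)) =
        Real.exp (-(κ * Real.exp 1)) := by simp
    rw [← h5]
    refine setIntegral_mono_on (integrableOn_const (by simp)) hint.integrableOn
      measurableSet_Ioc fun x hx => Real.exp_le_exp.2 ?_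
    have h6 : Real.exp x ≤ Real.exp 1 := Real.exp_le_exp.2 hx.2
    have h7 := mul_le_mul_of_nonneg_left h6 hκ.le
    have h8 : 0 ≤ s * x := mul_nonneg hs0.le hx.1.le
    linarith
  rw [← integral_add_compl measurableSet_Iic hint, Set.compl_Iic]
  have h9 : 1 ≤ Real.exp (κ * Real.exp 1) *
      ∫ x in Set.Ioi (0 : ℝ), Real.exp (s * x - κ * Real.exp x) := by
    have := mul_le_mul_of_nonneg_left h3 (Real.exp_pos (κ * Real.exp 1)).le
    rwa [← Real.exp_add, add_neg_cancel, Real.exp_zero] at this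
  linarith

/-! ## Herglotz polynomials -/

/-- The function `ζ ↦ e^{qζ} w(ζ)²`. -/
def radialWeight (κ : ℝ) (q : ℤ) (ζ : ℝ) : ℝ :=
  Real.exp (q * ζ) * Real.exp (-κ * Real.sinh |ζ| + 1 / 4 * |ζ|) ^ 2

theorem radialWeight_pos (κ : ℝ) (q : ℤ) (ζ : ℝ) : 0 < radialWeight κ q ζ := by
  unfold radialWeight; positivity

theorem continuous_radialWeight (κ : ℝ) (q : ℤ) : Continuous (radialWeight κ q) := by
  unfold radialWeight
  have : Continuous Real.sinh := Real.continuous_sinh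
  fun_prop

theorem radialWeight_neg (κ : ℝ) (q : ℤ) (ζ : ℝ) :
    radialWeight κ (-q) ζ = radialWeight κ q (-ζ) := by
  simp [radialWeight]

/-- In `w²` the exponent is `-κ e^{|ζ|} + κ e^{-|ζ|} + |ζ|/2`, and the middle term is at most `κ`.
Adding the reflected function removes the absolute values. -/
theorem radialWeight_le {κ : ℝ} (hκ : 0 < κ) (n : ℕ) (ζ : ℝ) :
    radialWeight κ (2 * n) ζ ≤ Real.exp κ *
      (Real.exp ((2 * n + 1 / 2) * ζ - κ * Real.exp ζ) +
        Real.exp ((2 * n + 1 / 2) * (-ζ) - κ * Real.exp (-ζ))) := by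
  have h1 : radialWeight κ (2 * n) ζ ≤ Real.exp κ *
      Real.exp ((2 * n + 1 / 2) * |ζ| - κ * Real.exp |ζ|) := by
    rw [radialWeight, ← Real.exp_nat_mul, ← Real.exp_add, ← Real.exp_add, Real.exp_le_exp,
      Real.sinh_eq]
    have h2 : Real.exp (-|ζ|) ≤ 1 := Real.exp_le_one_iff.2 (by simp)
    have h3 := mul_le_mul_of_nonneg_left h2 hκ.le
    have h4 : (2 * n : ℝ) * ζ ≤ 2 * n * |ζ| := by
      have := le_abs_self ζ
      gcongr
    push_cast
    linarith
  refine h1.trans (mul_le_mul_of_nonneg_left ?_ (Real.exp_pos _).le)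
  rcases abs_choice ζ with h | h <;> rw [h]
  · exact le_add_of_nonneg_right (Real.exp_pos _).le
  · exact le_add_of_nonneg_left (Real.exp_pos _).le

theorem le_radialWeight {κ : ℝ} (hκ : 0 < κ) (n : ℕ) {ζ : ℝ} (hζ : 0 < ζ) :
    Real.exp ((2 * n + 1 / 2) * ζ - κ * Real.exp ζ) ≤ radialWeight κ (2 * n) ζ := by
  rw [radialWeight, ← Real.exp_nat_mul, ← Real.exp_add, Real.exp_le_exp, Real.sinh_eq,
    abs_of_pos hζ]
  have := mul_pos hκ (Real.exp_pos (-ζ))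
  push_cast
  linarith

theorem integrable_radialWeight_natCast {κ : ℝ} (hκ : 0 < κ) (n : ℕ) :
    Integrable (radialWeight κ (2 * n)) := by
  have hs : (0 : ℝ) < 2 * n + 1 / 2 := by positivity
  have h1 := (integrable_exp_sub_exp hκ hs).1
  refine ((h1.add h1.comp_neg).const_mul (Real.exp κ)).mono'
    (continuous_radialWeight κ _).aestronglyMeasurable
    (Filter.Eventually.of_forall fun ζ => ?_)
  rw [Real.norm_of_nonneg (radialWeight_pos _ _ _).le]
  exact radialWeight_le hκ n ζ

theorem integrable_radialWeight {κ : ℝ} (hκ : 0 < κ) (p : ℤ) :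
    Integrable (radialWeight κ (2 * p)) := by
  obtain ⟨n, rfl | rfl⟩ := p.eq_nat_or_neg
  · exact integrable_radialWeight_natCast hκ n
  · refine ((integrable_radialWeight_natCast hκ n).comp_neg).congr
      (Filter.Eventually.of_forall fun ζ => ?_)
    rw [mul_neg, radialWeight_neg]

theorem integral_radialWeight_natAbs (κ : ℝ) (p : ℤ) :
    ∫ ζ, radialWeight κ (2 * p) ζ = ∫ ζ, radialWeight κ (2 * (p.natAbs : ℤ)) ζ := by
  rcases Int.natAbs_eq p with h | h
  · rw [← h]
  · conv_lhs => rw [h]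
    simp only [mul_neg, radialWeight_neg]
    exact integral_neg_eq_self _ _

theorem integral_radialWeight_pos {κ : ℝ} (hκ : 0 < κ) (p : ℤ) :
    0 < ∫ ζ, radialWeight κ (2 * p) ζ := by
  refine (integral_pos_iff_support_of_nonneg (fun ζ => (radialWeight_pos κ _ ζ).le)
    (integrable_radialWeight hκ p)).2 ?_
  have : Function.support (radialWeight κ (2 * p)) = Set.univ :=
    Set.eq_univ_of_forall fun ζ => (radialWeight_pos κ _ ζ).ne'
  simp [this]

theorem integral_radialWeight_le {κ : ℝ} (hκ : 0 < κ) (n : ℕ) :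
    ∫ ζ, radialWeight κ (2 * n) ζ ≤
      2 * Real.exp κ * ((1 / κ) ^ (2 * n + 1 / 2 : ℝ) * Real.Gamma (2 * n + 1 / 2)) := by
  have hs : (0 : ℝ) < 2 * n + 1 / 2 := by positivity
  obtain ⟨h1, h2⟩ := integrable_exp_sub_exp hκ hs
  have h3 := integral_mono (integrable_radialWeight_natCast hκ n)
    ((h1.add h1.comp_neg).const_mul (Real.exp κ)) (radialWeight_le hκ n)
  refine h3.trans (le_of_eq ?_)
  have h4 := integral_neg_eq_self
    (fun ζ : ℝ => Real.exp ((2 * n + 1 / 2) * ζ - κ * Real.exp ζ)) volume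
  rw [integral_const_mul, ← h2]
  change Real.exp κ * ∫ ζ, (Real.exp ((2 * n + 1 / 2) * ζ - κ * Real.exp ζ) +
    Real.exp ((2 * n + 1 / 2) * (-ζ) - κ * Real.exp (-ζ))) = _
  rw [integral_add h1 h1.comp_neg, h4]
  ring

theorem le_integral_radialWeight {κ : ℝ} (hκ : 0 < κ) (n : ℕ) :
    (1 / κ) ^ (2 * n + 1 / 2 : ℝ) * Real.Gamma (2 * n + 1 / 2) ≤
      (1 + 2 * Real.exp (κ * Real.exp 1)) * ∫ ζ, radialWeight κ (2 * n) ζ := by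
  have hs : (0 : ℝ) < 2 * n + 1 / 2 := by positivity
  obtain ⟨h1, h2⟩ := integrable_exp_sub_exp hκ hs
  rw [← h2]
  refine (integral_exp_sub_exp_le hκ (by linarith [n.cast_nonneg (α := ℝ)])).trans ?_
  refine mul_le_mul_of_nonneg_left ?_ (by positivity)
  have hW := integrable_radialWeight_natCast hκ n
  refine le_trans ?_ (setIntegral_le_integral (s := Set.Ioi 0) hW
    (Filter.Eventually.of_forall fun ζ => (radialWeight_pos κ _ ζ).le))
  exact setIntegral_mono_on h1.integrableOn hW.integrableOn measurableSet_Ioi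
    fun ζ hζ => le_radialWeight hκ n hζ

/-! ### Orthogonality and norms in the weighted `L²` space on the cylinder. -/

theorem measurable_weight_sq (κ : ℝ) :
    Measurable fun y : Cylinder => ENNReal.ofReal (weight κ y ^ 2) := by
  have : Continuous Real.sinh := Real.continuous_sinh
  have h : Continuous fun y : Cylinder => weight κ y ^ 2 := by
    unfold weight weightZ
    fun_prop
  exact ENNReal.measurable_ofReal.comp h.measurable

theorem continuous_herglotzPolynomial (p : ℤ) : Continuous (herglotzPolynomial p) := by
  unfold herglotzPolynomial
  fun_prop

theorem norm_herglotzPolynomial (p : ℤ) (y : Cylinder) :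
    ‖herglotzPolynomial p y‖ = Real.exp (p * y.2) := by
  rw [herglotzPolynomial, norm_mul, Complex.norm_exp, Complex.norm_exp]
  simp

instance : IsFiniteMeasure (Measure.comap Subtype.val (volume : Measure ℝ) :
    Measure (Set.Ico (0 : ℝ) (2 * Real.pi))) :=
  ⟨by
    rw [(MeasurableEmbedding.subtype_coe measurableSet_Ico).comap_apply, Set.image_univ,
      Subtype.range_coe]
    exact measure_Ico_lt_top⟩

theorem weight_sq_mul_norm_herglotzPolynomial_sq (κ : ℝ) (p : ℤ) (y : Cylinder) :
    weight κ y ^ 2 * ‖herglotzPolynomial p y‖ ^ 2 = 1 * radialWeight κ (2 * p) y.2 := by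
  rw [norm_herglotzPolynomial, weight, weightZ, radialWeight, ← Real.exp_nat_mul (p * y.2)]
  push_cast
  rw [mul_assoc, one_mul, mul_comm]

theorem memLp_herglotzPolynomial {κ : ℝ} (hκ : 0 < κ) (p : ℤ) :
    MemLp (herglotzPolynomial p) 2 (cylinderMeasure κ) := by
  rw [memLp_two_iff_integrable_sq_norm
    (continuous_herglotzPolynomial p).measurable.aestronglyMeasurable, cylinderMeasure,
    integrable_withDensity_iff_integrable_smul' (measurable_weight_sq κ)
      (Filter.Eventually.of_forall fun _ => ENNReal.ofReal_lt_top)]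
  have h : ∀ y : Cylinder, (ENNReal.ofReal (weight κ y ^ 2)).toReal •
      ‖herglotzPolynomial p y‖ ^ 2 = 1 * radialWeight κ (2 * p) y.2 := by
    intro y
    rw [ENNReal.toReal_ofReal (sq_nonneg _), smul_eq_mul,
      weight_sq_mul_norm_herglotzPolynomial_sq]
  simp only [h]
  exact Integrable.mul_prod (f := fun _ => (1 : ℝ)) (integrable_const 1)
    (integrable_radialWeight hκ p)

/-- Fubini separates the angle from `ζ`. The angular factor gives orthogonality, and the radial one
gives the norms. -/
theorem integral_cylinder_herglotz_mul (κ : ℝ) (p q : ℤ) :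
    ∫ y, herglotzPolynomial q y * (starRingEnd ℂ) (herglotzPolynomial p y) ∂(cylinderMeasure κ) =
      (∫ φ in Set.Ico (0 : ℝ) (2 * Real.pi), Complex.exp (Complex.I * ((q - p : ℤ) : ℂ) * φ)) *
        ((∫ ζ, radialWeight κ (p + q) ζ : ℝ) : ℂ) := by
  rw [cylinderMeasure, integral_withDensity_eq_integral_toReal_smul (measurable_weight_sq κ)
      (Filter.Eventually.of_forall fun _ => ENNReal.ofReal_lt_top)]
  have h : ∀ y : Cylinder, (ENNReal.ofReal (weight κ y ^ 2)).toReal •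
      (herglotzPolynomial q y * (starRingEnd ℂ) (herglotzPolynomial p y)) =
      Complex.exp (Complex.I * ((q - p : ℤ) : ℂ) * ((y.1 : ℝ) : ℂ)) *
        ((radialWeight κ (p + q) y.2 : ℝ) : ℂ) := by
    intro y
    rw [ENNReal.toReal_ofReal (sq_nonneg _), Complex.real_smul, weight, weightZ, radialWeight,
      herglotzPolynomial, herglotzPolynomial]
    simp only [map_mul, ← Complex.exp_conj, Complex.conj_ofReal, Complex.conj_I, map_intCast]
    push_cast
    simp only [← Complex.exp_nat_mul, ← Complex.exp_add]
    congr 1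
    push_cast
    ring
  simp only [h]
  rw [lebesgueCylinder, integral_prod_mul
    (f := fun φ : Set.Ico (0 : ℝ) (2 * Real.pi) =>
      Complex.exp (Complex.I * ((q - p : ℤ) : ℂ) * ((φ : ℝ) : ℂ)))
    (g := fun ζ => ((radialWeight κ (p + q) ζ : ℝ) : ℂ)), integral_complex_ofReal]
  congr 1
  exact integral_subtype_comap measurableSet_Ico
    (fun φ : ℝ => Complex.exp (Complex.I * ((q - p : ℤ) : ℂ) * φ))

theorem integral_exp_angle_of_ne_zero {m : ℤ} (hm : m ≠ 0) :
    ∫ φ in Set.Ico (0 : ℝ) (2 * Real.pi), Complex.exp (Complex.I * (m : ℂ) * φ) = 0 := by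
  have hm' : Complex.I * (m : ℂ) ≠ 0 :=
    mul_ne_zero Complex.I_ne_zero (by exact_mod_cast hm)
  rw [integral_Ico_eq_integral_Ioc, ← intervalIntegral.integral_of_le (by positivity),
    integral_exp_mul_complex hm']
  have : Complex.I * (m : ℂ) * ((2 * Real.pi : ℝ) : ℂ) = (m : ℂ) * (2 * Real.pi * Complex.I) := by
    push_cast; ring
  rw [this, Complex.exp_int_mul_two_pi_mul_I]
  simp

theorem normA_herglotzPolynomial_sq (κ : ℝ) (p : ℤ) :
    normA κ (herglotzPolynomial p) ^ 2 = 2 * Real.pi * ∫ ζ, radialWeight κ (2 * p) ζ := by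
  rw [normA, Real.sq_sqrt (integral_nonneg fun _ => by positivity)]
  have h := integral_cylinder_herglotz_mul κ p p
  simp only [Complex.mul_conj, Complex.normSq_eq_norm_sq, sub_self, Int.cast_zero, mul_zero,
    zero_mul, Complex.exp_zero, ← two_mul] at h
  rw [integral_complex_ofReal] at h
  have h1 : ∫ _ in Set.Ico (0 : ℝ) (2 * Real.pi), (1 : ℂ) = ((2 * Real.pi : ℝ) : ℂ) := by
    simp [Real.pi_pos.le]
  rw [h1] at h
  exact_mod_cast h

theorem normA_herglotzPolynomial_pos {κ : ℝ} (hκ : 0 < κ) (p : ℤ) :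
    0 < normA κ (herglotzPolynomial p) := by
  refine (Real.sqrt_nonneg _).lt_of_ne fun h => ?_
  have h1 := normA_herglotzPolynomial_sq κ p
  have h2 := integral_radialWeight_pos hκ p
  have h3 := Real.pi_pos
  change 0 = normA κ (herglotzPolynomial p) at h
  rw [← h] at h1
  have : 0 < 2 * Real.pi * ∫ ζ, radialWeight κ (2 * p) ζ := by positivity
  rw [← h1] at this
  simp at this

/-- The normalized Herglotz polynomial `a_p = α_p ã_p`. -/
def normalizedHerglotz (κ : ℝ) (p : ℤ) (y : Cylinder) : ℂ :=
  (alpha κ p : ℂ) * herglotzPolynomial p y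

theorem memLp_normalizedHerglotz {κ : ℝ} (hκ : 0 < κ) (p : ℤ) :
    MemLp (normalizedHerglotz κ p) 2 (cylinderMeasure κ) :=
  (memLp_herglotzPolynomial hκ p).const_mul _

theorem orthonormal_normalizedHerglotz {κ : ℝ} (hκ : 0 < κ) :
    Orthonormal ℂ fun p => (memLp_normalizedHerglotz hκ p).toLp (normalizedHerglotz κ p) := by
  rw [orthonormal_iff_ite]
  intro p q
  have h : inner ℂ ((memLp_normalizedHerglotz hκ p).toLp (normalizedHerglotz κ p))
      ((memLp_normalizedHerglotz hκ q).toLp (normalizedHerglotz κ q)) =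
      (alpha κ p * alpha κ q : ℂ) * ∫ y, herglotzPolynomial q y *
        (starRingEnd ℂ) (herglotzPolynomial p y) ∂(cylinderMeasure κ) := by
    rw [L2.inner_def, ← integral_const_mul]
    refine integral_congr_ae ?_
    filter_upwards [(memLp_normalizedHerglotz hκ p).coeFn_toLp,
      (memLp_normalizedHerglotz hκ q).coeFn_toLp] with y h1 h2
    rw [h1, h2, RCLike.inner_apply, normalizedHerglotz, normalizedHerglotz, map_mul,
      Complex.conj_ofReal]
    ring
  rw [h]
  split_ifs with hpq
  · subst hpq
    have h1 : ∀ y, herglotzPolynomial p y * (starRingEnd ℂ) (herglotzPolynomial p y) =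
        ((‖herglotzPolynomial p y‖ ^ 2 : ℝ) : ℂ) := by
      intro y
      rw [Complex.mul_conj, Complex.normSq_eq_norm_sq]
    have h2 : ∫ y, ‖herglotzPolynomial p y‖ ^ 2 ∂(cylinderMeasure κ) =
        normA κ (herglotzPolynomial p) ^ 2 := by
      rw [normA, Real.sq_sqrt (integral_nonneg fun _ => by positivity)]
    have h3 := (normA_herglotzPolynomial_pos hκ p).ne'
    simp only [h1]
    rw [integral_complex_ofReal, h2, alpha]
    norm_cast
    field_simp
  · rw [integral_cylinder_herglotz_mul, integral_exp_angle_of_ne_zero (by omega), zero_mul,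
      mul_zero]

/-! ## Bounds for `τ_p` -/

theorem norm_tau (hκ : 0 < κ) (p : ℤ) :
    ‖tau hκ p‖ = normA κ (herglotzPolynomial p) * ‖circularWave hκ p‖ := by
  have h1 := normA_herglotzPolynomial_pos hκ p
  have h2 := norm_circularWave_pos hκ p
  rw [tau, norm_mul, norm_zpow, Complex.norm_I, one_zpow, one_mul, norm_inv, Complex.norm_real,
    alpha, beta, ← mul_inv, norm_inv, inv_inv, Real.norm_of_nonneg (by positivity)]

theorem norm_tau_pos (hκ : 0 < κ) (p : ℤ) : 0 < ‖tau hκ p‖ := by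
  rw [norm_tau]
  exact mul_pos (normA_herglotzPolynomial_pos hκ p) (norm_circularWave_pos hκ p)

theorem norm_tau_natAbs (hκ : 0 < κ) (p : ℤ) : ‖tau hκ p‖ = ‖tau hκ (p.natAbs : ℤ)‖ := by
  have h : normA κ (herglotzPolynomial p) = normA κ (herglotzPolynomial (p.natAbs : ℤ)) := by
    refine (sq_eq_sq₀ (Real.sqrt_nonneg _) (Real.sqrt_nonneg _)).1 ?_
    change normA κ _ ^ 2 = normA κ _ ^ 2
    rw [normA_herglotzPolynomial_sq, normA_herglotzPolynomial_sq, integral_radialWeight_natAbs]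
  rw [norm_tau, norm_tau, h, norm_circularWave_natAbs]

/-- The growth of `‖ã_n‖²` meets that of `‖b̃_n‖²` here: all `n`-dependent powers of `κ` cancel. -/
theorem gamma_mul_circularRate (hκ : 0 < κ) (n : ℕ) :
    (1 / κ) ^ (2 * n + 1 / 2 : ℝ) * Real.Gamma (2 * n + 1 / 2) * circularRate κ n =
      (1 / κ) ^ (1 / 2 : ℝ) * gammaRatio n := by
  have h2 : (n.factorial : ℝ) ≠ 0 := by exact_mod_cast n.factorial_ne_zero
  have e : (1 / κ) ^ (2 * n + 1 / 2 : ℝ) = (1 / κ) ^ (2 * n) * (1 / κ) ^ (1 / 2 : ℝ) := by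
    rw [Real.rpow_add (by positivity)]
    congr 1
    rw [← Real.rpow_natCast]
    push_cast
    rfl
  have e4 : (4 : ℝ) ^ n = 2 ^ (2 * n) := by rw [pow_mul]; norm_num
  rw [e, circularRate, gammaRatio, e4, div_pow, div_pow, one_pow]
  field_simp

theorem exists_bounds_norm_tau_eventually (hκ : 0 < κ) :
    ∃ c C : ℝ, 0 < c ∧ ∃ n₀ : ℕ, ∀ n : ℕ, n₀ ≤ n → c ≤ ‖tau hκ n‖ ^ 2 ∧ ‖tau hκ n‖ ^ 2 ≤ C := by
  obtain ⟨c, C, hc, hC, n₀, hn₀⟩ := exists_bounds_norm_sq_circularWave hκ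
  have hg := gammaRatio_pos le_rfl
  have hk : 0 < (1 / κ) ^ (1 / 2 : ℝ) := by positivity
  set L : ℝ := 1 + 2 * Real.exp (κ * Real.exp 1) with hL
  have hL0 : 0 < L := by positivity
  have hpi := Real.pi_pos
  refine ⟨2 * Real.pi * (L⁻¹ * c * ((1 / κ) ^ (1 / 2 : ℝ) * gammaRatio 1)),
    2 * Real.pi * (2 * Real.exp κ * C * ((1 / κ) ^ (1 / 2 : ℝ) * (2 * gammaRatio 1))),
    -- The shift guarantees `n ≥ 1`; at `n = 0` the rate is zero.
    by positivity, n₀ + 1, fun n hn => ?_⟩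
  have hn1 : 1 ≤ n := by omega
  have hR := circularRate_pos hκ hn1
  have hW := integral_radialWeight_pos hκ n
  obtain ⟨hlo, hhi⟩ := hn₀ n (by omega)
  rw [norm_tau, mul_pow, normA_herglotzPolynomial_sq, mul_assoc (2 * Real.pi)]
  have hgam : 0 < (1 / κ) ^ (2 * n + 1 / 2 : ℝ) * Real.Gamma (2 * n + 1 / 2) :=
    mul_pos (Real.rpow_pos_of_pos (by positivity) _) (Real.Gamma_pos_of_pos (by positivity))
  constructor
  · refine mul_le_mul_of_nonneg_left ?_ (by positivity)
    have h1 : L⁻¹ * ((1 / κ) ^ (2 * n + 1 / 2 : ℝ) * Real.Gamma (2 * n + 1 / 2)) ≤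
        ∫ ζ, radialWeight κ (2 * n) ζ := by
      rw [inv_mul_le_iff₀ hL0]
      exact le_integral_radialWeight hκ n
    calc _ ≤ L⁻¹ * c * ((1 / κ) ^ (1 / 2 : ℝ) * gammaRatio n) := by
          gcongr
          exact (gammaRatio_bounds hn1).1
      _ = L⁻¹ * ((1 / κ) ^ (2 * n + 1 / 2 : ℝ) * Real.Gamma (2 * n + 1 / 2)) *
          (c * circularRate κ n) := by
        rw [← gamma_mul_circularRate hκ]; ring
      _ ≤ _ := by gcongr
  · refine mul_le_mul_of_nonneg_left ?_ (by positivity)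
    calc _ ≤ 2 * Real.exp κ * ((1 / κ) ^ (2 * n + 1 / 2 : ℝ) * Real.Gamma (2 * n + 1 / 2)) *
          (C * circularRate κ n) := by
          gcongr
          exact integral_radialWeight_le hκ n
      _ = 2 * Real.exp κ * C * ((1 / κ) ^ (1 / 2 : ℝ) * gammaRatio n) := by
        rw [← gamma_mul_circularRate hκ]; ring
      _ ≤ _ := by
        gcongr
        exact gammaRatio_le hn1

/-- By the symmetry in `p`, the bounds for large orders only have to be combined with the minimum
and maximum over finitely many positive numbers. -/
theorem exists_bounds_norm_tau (hκ : 0 < κ) :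
    ∃ c C : ℝ, 0 < c ∧ ∀ p : ℤ, c ≤ ‖tau hκ p‖ ∧ ‖tau hκ p‖ ≤ C := by
  obtain ⟨c, C, hc, n₀, h⟩ := exists_bounds_norm_tau_eventually hκ
  obtain ⟨i, -, hi⟩ := (Finset.range (n₀ + 1)).exists_min_image (fun n : ℕ => ‖tau hκ n‖)
    ⟨0, by simp⟩
  obtain ⟨k, -, hk⟩ := (Finset.range (n₀ + 1)).exists_max_image (fun n : ℕ => ‖tau hκ n‖)
    ⟨0, by simp⟩
  refine ⟨min (Real.sqrt c) ‖tau hκ i‖, max (Real.sqrt C) ‖tau hκ k‖,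
    lt_min (Real.sqrt_pos.2 hc) (norm_tau_pos hκ i), fun p => ?_⟩
  rw [norm_tau_natAbs hκ p]
  rcases le_total n₀ p.natAbs with hp | hp
  · obtain ⟨h1, h2⟩ := h _ hp
    exact ⟨(min_le_left _ _).trans (Real.sqrt_le_iff.2 ⟨norm_nonneg _, h1⟩),
      (Real.le_sqrt_of_sq_le h2).trans (le_max_left _ _)⟩
  · have hm : p.natAbs ∈ Finset.range (n₀ + 1) := by simpa using Nat.lt_succ_of_le hp
    exact ⟨(min_le_right _ _).trans (hi _ hm), (hk _ hm).trans (le_max_right _ _)⟩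

/-! ## Continuous frames obtained from an orthonormal system -/

theorem lintegral_enorm_sq_Lp {M : Type*} [MeasurableSpace M] {μ : Measure M} (S : Lp ℂ 2 μ) :
    ∫⁻ y, ‖S y‖ₑ ^ 2 ∂μ = ENNReal.ofReal (‖S‖ ^ 2) := by
  have h := eLpNorm_nnreal_pow_eq_lintegral (f := S) (μ := μ) (p := 2) two_ne_zero
  simp only [NNReal.coe_ofNat, ENNReal.rpow_ofNat, ENNReal.coe_ofNat] at h
  rw [← h, Lp.norm_def, ENNReal.ofReal_pow ENNReal.toReal_nonneg,
    ENNReal.ofReal_toReal (Lp.eLpNorm_ne_top S)]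

/-- In a Hilbert space, an `ℓ²` combination of an orthonormal family converges, and its norm is
the `ℓ²` norm of the coefficients. -/
theorem exists_hasSum_smul_of_orthonormal {E ι : Type*} [NormedAddCommGroup E]
    [InnerProductSpace ℂ E] [CompleteSpace E] {v : ι → E} (hv : Orthonormal ℂ v) {c : ι → ℂ}
    (hc : Summable fun i => ‖c i‖ ^ 2) :
    ∃ S : E, HasSum (fun i => c i • v i) S ∧ ‖S‖ ^ 2 = ∑' i, ‖c i‖ ^ 2 := by
  have hm : Memℓp c 2 := memℓp_gen (by simpa using hc)
  let f : lp (fun _ : ι => ℂ) 2 := ⟨c, hm⟩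
  refine ⟨hv.orthogonalFamily.linearIsometry f, ?_, ?_⟩
  · exact hv.orthogonalFamily.hasSum_linearIsometry f
  · rw [LinearIsometry.norm_map]
    have := lp.norm_rpow_eq_tsum (p := 2) (by simp) f
    simpa using this

section Frame

variable {H : Type*} [NormedAddCommGroup H] [InnerProductSpace ℂ H]
  {M : Type*} {b : HilbertBasis ℤ ℂ H} {a : ℤ → M → ℂ} {τ : ℤ → ℂ} {Φ : M → H}

theorem hasSum_inner_of_hasSum_smul
    (hΦ : ∀ y, HasSum (fun p => (τ p * (starRingEnd ℂ) (a p y)) • b p) (Φ y)) (u : H) (y : M) :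
    HasSum (fun p => (starRingEnd ℂ) (τ p) * inner ℂ (b p) u * a p y) (inner ℂ (Φ y) u) := by
  have h := (hΦ y).mapL (innerSL ℂ u)
  simp only [innerSL_apply_apply, inner_smul_right] at h
  rw [← inner_conj_symm]
  refine ((Complex.hasSum_conj (x := (starRingEnd ℂ) (inner ℂ u (Φ y)))).2
    (by simpa using h)).congr_fun fun p => ?_
  simp only [map_mul, Complex.conj_conj, inner_conj_symm]
  ring

theorem hasSum_norm_inner_sq (b : HilbertBasis ℤ ℂ H) (u : H) :
    HasSum (fun p => ‖inner ℂ (b p) u‖ ^ 2) (‖u‖ ^ 2) := by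
  have h := b.hasSum_inner_mul_inner u u
  rw [inner_self_eq_norm_sq_to_K] at h
  rw [← Complex.hasSum_ofReal]
  push_cast
  refine h.congr_fun fun p => ?_
  rw [← inner_conj_symm u (b p), mul_comm, Complex.mul_conj, Complex.normSq_eq_norm_sq]
  push_cast
  rfl

variable [MeasurableSpace M] {μ : Measure M}

/-- Parseval's identity in `L²(μ)`. Boundedness of `τ` makes the coefficients square summable, so
the series converges in `L²`; its sum agrees almost everywhere with the pointwise expansion of `(u,
Φ y)`. -/
theorem lintegral_enorm_inner_sq (ha2 : ∀ p, MemLp (a p) 2 μ)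
    (hortho : Orthonormal ℂ fun p => (ha2 p).toLp (a p))
    (hΦ : ∀ y, HasSum (fun p => (τ p * (starRingEnd ℂ) (a p y)) • b p) (Φ y))
    (hτ : BddAbove (Set.range fun p => ‖τ p‖)) (u : H) :
    (Summable fun p => ‖τ p‖ ^ 2 * ‖inner ℂ (b p) u‖ ^ 2) ∧
      ∫⁻ y, ‖inner ℂ (Φ y) u‖ₑ ^ 2 ∂μ =
        ENNReal.ofReal (∑' p, ‖τ p‖ ^ 2 * ‖inner ℂ (b p) u‖ ^ 2) := by
  obtain ⟨C, hC⟩ := hτ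
  have hC' : ∀ p, ‖τ p‖ ≤ C := fun p => hC ⟨p, rfl⟩
  have hs : Summable fun p => ‖τ p‖ ^ 2 * ‖inner ℂ (b p) u‖ ^ 2 := by
    refine Summable.of_nonneg_of_le (fun p => by positivity) (fun p => ?_)
      ((hasSum_norm_inner_sq b u).summable.mul_left (C ^ 2))
    have := hC' p
    gcongr
  refine ⟨hs, ?_⟩
  have hn : ∀ p, ‖(starRingEnd ℂ) (τ p) * inner ℂ (b p) u‖ ^ 2 =
      ‖τ p‖ ^ 2 * ‖inner ℂ (b p) u‖ ^ 2 := by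
    intro p
    rw [norm_mul, mul_pow, RCLike.norm_conj]
  obtain ⟨S, hS, hSn⟩ := exists_hasSum_smul_of_orthonormal hortho
    (c := fun p => (starRingEnd ℂ) (τ p) * inner ℂ (b p) u) (hs.congr fun p => (hn p).symm)
  simp only [hn] at hSn
  rw [← hSn, ← lintegral_enorm_sq_Lp]
  refine lintegral_congr_ae ?_
  have hae : S =ᵐ[μ] fun y => inner ℂ (Φ y) u := by
    refine ae_eq_of_hasSum_Lp hS ?_
    filter_upwards [ae_all_iff.2 fun p => (ha2 p).coeFn_toLp, ae_all_iff.2 fun p =>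
      Lp.coeFn_smul ((starRingEnd ℂ) (τ p) * inner ℂ (b p) u) ((ha2 p).toLp (a p))] with y h1 h2
    simp only [h2, Pi.smul_apply, h1, smul_eq_mul]
    exact hasSum_inner_of_hasSum_smul hΦ u y
  filter_upwards [hae] with y hy
  rw [hy]

variable [CompleteSpace H]

/-- A family `Φ = ∑ₚ τ_p conj(a_p) b_p`, where `b` is a Hilbert basis and `a` is an orthonormal
system in `L²(μ)`, is a continuous frame if `|τ|` is bounded above and away from zero, and its
optimal frame bounds are the infimum and the supremum of `|τ|²`. -/
theorem isContinuousFrame_of_hasSum (ha : ∀ p, Measurable (a p)) (ha2 : ∀ p, MemLp (a p) 2 μ)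
    (hortho : Orthonormal ℂ fun p => (ha2 p).toLp (a p))
    (hΦ : ∀ y, HasSum (fun p => (τ p * (starRingEnd ℂ) (a p y)) • b p) (Φ y))
    (hτ0 : 0 < ⨅ p, ‖τ p‖) (hτ : BddAbove (Set.range fun p => ‖τ p‖)) :
    IsContinuousFrame μ Φ ∧
      IsGreatest {A : ℝ | IsLowerFrameBound μ Φ A} ((⨅ p, ‖τ p‖) ^ 2) ∧
      IsLeast {B : ℝ | IsUpperFrameBound μ Φ B} ((⨆ p, ‖τ p‖) ^ 2) := by
  have hbelow : BddBelow (Set.range fun p => ‖τ p‖) := ⟨0, by rintro _ ⟨p, rfl⟩; positivity⟩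
  have key := lintegral_enorm_inner_sq ha2 hortho hΦ hτ
  have hpars := hasSum_norm_inner_sq b
  have hsup : 0 < ⨆ p, ‖τ p‖ := hτ0.trans_le ((ciInf_le hbelow 0).trans (le_ciSup hτ 0))
  have hlow : IsLowerFrameBound μ Φ ((⨅ p, ‖τ p‖) ^ 2) := by
    refine ⟨by positivity, fun u => ?_⟩
    rw [(key u).2]
    refine ENNReal.ofReal_le_ofReal ?_
    refine hasSum_le (fun p => ?_) ((hpars u).mul_left _) (key u).1.hasSum
    have := ciInf_le hbelow p
    gcongr
  have hupp : IsUpperFrameBound μ Φ ((⨆ p, ‖τ p‖) ^ 2) := by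
    refine ⟨by positivity, fun u => ?_⟩
    rw [(key u).2]
    refine ENNReal.ofReal_le_ofReal ?_
    refine hasSum_le (fun p => ?_) (key u).1.hasSum ((hpars u).mul_left _)
    have := le_ciSup hτ p
    gcongr
  -- At a basis vector the diagonal sum has a single term, so any frame bound is compared directly
  -- with `‖τ q‖ ^ 2`. This gives optimality even if the infimum or supremum is not attained.
  have hb (q : ℤ) : ∫⁻ y, ‖inner ℂ (Φ y) (b q)‖ₑ ^ 2 ∂μ = ENNReal.ofReal (‖τ q‖ ^ 2) := by
    rw [(key (b q)).2, tsum_eq_single q]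
    · rw [inner_self_eq_norm_sq_to_K, b.orthonormal.1 q]
      simp
    · intro p hp
      rw [b.orthonormal.2 hp]
      simp
  refine ⟨⟨fun u => ?_, ⟨_, hlow⟩, ⟨_, hupp⟩⟩, ⟨hlow, fun A hA => ?_⟩, ⟨hupp, fun B hB => ?_⟩⟩
  · refine measurable_of_tendsto_metrizable' (f := fun (s : Finset ℤ) y =>
      ∑ p ∈ s, (starRingEnd ℂ) (τ p) * inner ℂ (b p) u * a p y) Filter.atTop
      (fun s => Finset.measurable_fun_sum s fun p _ => (ha p).const_mul _) ?_
    exact tendsto_pi_nhds.2 fun y => hasSum_inner_of_hasSum_smul hΦ u y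
  · have h1 : ∀ q, Real.sqrt A ≤ ‖τ q‖ := by
      intro q
      have h2 := hA.2 (b q)
      rw [hb, b.orthonormal.1 q, ENNReal.ofReal_le_ofReal_iff (by positivity)] at h2
      exact Real.sqrt_le_iff.2 ⟨norm_nonneg _, by simpa using h2⟩
    have h3 : Real.sqrt A ≤ ⨅ p, ‖τ p‖ := le_ciInf h1
    exact (Real.sqrt_le_left hτ0.le).1 h3
  · have h1 : ∀ q, ‖τ q‖ ≤ Real.sqrt B := by
      intro q
      have h2 := hB.2 (b q)
      rw [hb, b.orthonormal.1 q, ENNReal.ofReal_le_ofReal_iff (by simpa using hB.1.le)] at h2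
      exact Real.le_sqrt_of_sq_le (by simpa using h2)
    exact (Real.le_sqrt hsup.le hB.1.le).1 (ciSup_le h1)

end Frame

/-! ## The frame of evanescent plane waves -/

theorem orthonormal_normalizedWave (hκ : 0 < κ) : Orthonormal ℂ (normalizedWave hκ) := by
  refine ⟨fun p => ?_, fun p q hpq => ?_⟩
  · have h := norm_circularWave_pos hκ p
    rw [normalizedWave, norm_smul, Complex.norm_real, beta, norm_inv, norm_norm,
      inv_mul_cancel₀ h.ne']
  · change inner ℂ ((beta hκ p : ℂ) • circularWave hκ p) ((beta hκ q : ℂ) • circularWave hκ q) = 0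
    rw [inner_smul_left, inner_smul_right, inner_circularWave_of_ne hκ hpq, mul_zero, mul_zero]

theorem normalizedWave_mem_spaceB (hκ : 0 < κ) (p : ℤ) : normalizedWave hκ p ∈ spaceB hκ :=
  Submodule.le_topologicalClosure _ (Submodule.subset_span ⟨p, rfl⟩)

/-- The normalized circular wave as an element of `ℬ`. -/
def basisWave (hκ : 0 < κ) (p : ℤ) : spaceB hκ :=
  ⟨normalizedWave hκ p, normalizedWave_mem_spaceB hκ p⟩

theorem orthonormal_basisWave (hκ : 0 < κ) : Orthonormal ℂ (basisWave hκ) :=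
  ((spaceB hκ).subtypeₗᵢ.orthonormal_comp_iff).1 (orthonormal_normalizedWave hκ)

/-- If `u ∈ ℬ` is orthogonal to every `b_p`, the closed subspace `u^⊥` contains their span, hence
all of `ℬ`, hence `u` itself. -/
theorem orthogonal_span_basisWave (hκ : 0 < κ) :
    (Submodule.span ℂ (Set.range (basisWave hκ)))ᗮ = ⊥ := by
  rw [Submodule.eq_bot_iff]
  intro u hu
  have h1 : Submodule.span ℂ (Set.range (normalizedWave hκ)) ≤ (ℂ ∙ (u : H1 κ))ᗮ := by
    rw [Submodule.span_le]
    rintro _ ⟨p, rfl⟩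
    refine Submodule.mem_orthogonal_singleton_iff_inner_left.2 ?_
    have hp : basisWave hκ p ∈ Submodule.span ℂ (Set.range (basisWave hκ)) :=
      Submodule.subset_span ⟨p, rfl⟩
    have h0 : inner ℂ (basisWave hκ p) u = 0 := Submodule.inner_right_of_mem_orthogonal hp hu
    exact h0
  have h2 := Submodule.topologicalClosure_minimal _ h1 (Submodule.isClosed_orthogonal _) u.2
  rw [Submodule.mem_orthogonal_singleton_iff_inner_left, inner_self_eq_zero] at h2
  exact Subtype.ext h2

/-- The circular waves as a Hilbert basis of `ℬ`. -/
def waveBasis (hκ : 0 < κ) : HilbertBasis ℤ ℂ (spaceB hκ) :=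
  HilbertBasis.mkOfOrthogonalEqBot (orthonormal_basisWave hκ) (orthogonal_span_basisWave hκ)

theorem coe_waveBasis (hκ : 0 < κ) (p : ℤ) :
    ((waveBasis hκ p : spaceB hκ) : H1 κ) = normalizedWave hκ p := by
  rw [waveBasis, HilbertBasis.coe_mkOfOrthogonalEqBot]
  rfl

/-- The Jacobi–Anger coefficient contains `e^{-ip(φ + iζ)} = e^{pζ} e^{-ipφ}`, the conjugate of
`ã_p`; the definition of `τ_p` absorbs `i^p` and both normalizations. -/
theorem hasSum_normalizedWave (hκ : 0 < κ) (y : Cylinder) :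
    HasSum (fun p => (tau hκ p * (starRingEnd ℂ) (normalizedHerglotz κ p y)) •
      normalizedWave hκ p) (planeWave hκ y) := by
  refine (hasSum_circularWave hκ y).congr_fun fun p => ?_
  have ha : (alpha κ p : ℂ) ≠ 0 := by
    exact_mod_cast (inv_pos.2 (normA_herglotzPolynomial_pos hκ p)).ne'
  have hb : (beta hκ p : ℂ) ≠ 0 := by
    exact_mod_cast (inv_pos.2 (norm_circularWave_pos hκ p)).ne'
  have hq : Complex.exp (-(Complex.I * complexAngle y)) ^ p =
      (starRingEnd ℂ) (herglotzPolynomial p y) := by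
    rw [← Complex.exp_int_mul, herglotzPolynomial, map_mul, ← Complex.exp_conj, ← Complex.exp_conj,
      ← Complex.exp_add, complexAngle]
    congr 1
    simp only [map_mul, map_intCast, Complex.conj_ofReal, Complex.conj_I]
    linear_combination (-(p : ℂ) * (y.2 : ℂ)) * Complex.I_sq
  rw [normalizedWave, smul_smul, mul_zpow, hq, tau, normalizedHerglotz, map_mul,
    Complex.conj_ofReal]
  congr 1
  push_cast
  field_simp

theorem planeWave_mem_spaceB (hκ : 0 < κ) (y : Cylinder) : planeWave hκ y ∈ spaceB hκ := by
  refine (Submodule.isClosed_topologicalClosure _).mem_of_tendsto (hasSum_normalizedWave hκ y)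
    (Filter.Eventually.of_forall fun s => ?_)
  exact Submodule.sum_mem _ fun p _ => Submodule.smul_mem _ _ (normalizedWave_mem_spaceB hκ p)

/-- The evanescent plane wave as an element of `ℬ`. -/
def planeWaveB (hκ : 0 < κ) (y : Cylinder) : spaceB hκ :=
  ⟨planeWave hκ y, planeWave_mem_spaceB hκ y⟩

theorem hasSum_waveBasis (hκ : 0 < κ) (y : Cylinder) :
    HasSum (fun p => (tau hκ p * (starRingEnd ℂ) (normalizedHerglotz κ p y)) • waveBasis hκ p)
      (planeWaveB hκ y) := by
  refine (Topology.IsInducing.hasSum_iff (g := (spaceB hκ).subtype)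
    Topology.IsInducing.subtypeVal _ _).1 ?_
  refine (hasSum_normalizedWave hκ y).congr_fun fun p => ?_
  simp [coe_waveBasis]

end Helmholtz

end

/-- Finiteness of `τ₊` is a separate clause, because the real supremum of a set that is not bounded
above is zero by convention. -/
theorem theorem5p2 {κ : ℝ} (hκ : 0 < κ) :
    0 < Helmholtz.tauMinus hκ ∧
    BddAbove (Set.range fun p : ℤ => ‖Helmholtz.tau hκ p‖) ∧
    ∃ Φ : Helmholtz.Cylinder → Helmholtz.spaceB hκ,
      (∀ y, (Φ y : Helmholtz.H1 κ) = Helmholtz.planeWave hκ y) ∧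
      Helmholtz.IsContinuousFrame (Helmholtz.cylinderMeasure κ) Φ ∧
      IsGreatest {A : ℝ | Helmholtz.IsLowerFrameBound (Helmholtz.cylinderMeasure κ) Φ A}
        (Helmholtz.tauMinus hκ ^ 2) ∧
      IsLeast {B : ℝ | Helmholtz.IsUpperFrameBound (Helmholtz.cylinderMeasure κ) Φ B}
        (Helmholtz.tauPlus hκ ^ 2) := by
  obtain ⟨c, C, hc, hb⟩ := Helmholtz.exists_bounds_norm_tau hκ
  have h0 : 0 < Helmholtz.tauMinus hκ := hc.trans_le (le_ciInf fun p => (hb p).1)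
  have h1 : BddAbove (Set.range fun p : ℤ => ‖Helmholtz.tau hκ p‖) :=
    ⟨C, by rintro _ ⟨p, rfl⟩; exact (hb p).2⟩
  refine ⟨h0, h1, Helmholtz.planeWaveB hκ, fun y => rfl, ?_⟩
  exact Helmholtz.isContinuousFrame_of_hasSum
    (fun p => ((Helmholtz.continuous_herglotzPolynomial p).measurable.const_mul _))
    (Helmholtz.memLp_normalizedHerglotz hκ) (Helmholtz.orthonormal_normalizedHerglotz hκ)
    (Helmholtz.hasSum_waveBasis hκ) h0 h1
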